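/- Let $n\ge 3$, $d\ge 0$, let $e$ be a point of the unit sphere $S^{n-1}\subset\mathbb R^n$, and write $x\cdot y$ for the standard inner product. For $m\ge 2$ let $P_k^m$ be the zonal polynomial of degree $k$ of $S^{m-1}$: the Chebyshev polynomial of the first kind if $m=2$, and the Gegenbauer polynomial with parameter $m/2-1$, normalized by $P_k^m(1)=1$, if $m\ge 3$. Let $h_k^m$ be the dimension of the space of real harmonic homogeneous polynomials of degree $k$ in $m$ variables, and let $\omega_m$ be the surface area of $S^{m-1}$. For $0\le k\le d$ let $Y_k^n(u,v,t)$ be the $(d-k+1)\times(d-k+1)$ matrix of real polynomials in $u,v,t$ with entries, for $0\le i,j\le d-k$, $$(Y_k^n)_{i,j}(u,v,t)=\lambda_{i,j}\,P_i^{n+2k}(u)\,P_j^{n+2k}(v)\,\big((1-u^2)(1-v^2)\big)^{k/2}P_k^{n-1}\!\Big(\frac{t-uv}{\sqrt{(1-u^2)(1-v^2)}}\Big),$$ $$\lambda_{i,j}=\frac{\omega_n}{\omega_{n-1}}\,\frac{\omega_{n+2k-1}}{\omega_{n+2k}}\,\big(h_i^{n+2k}h_j^{n+2k}\big)^{1/2},$$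 and put $\overline Y_k^n(u,v,t)=\tfrac12\big(Y_k^n(u,v,t)+Y_k^n(v,u,t)\big)$ and $\langle A,B\rangle=\operatorname{Trace}(AB^t)$. Let $$R_d=\{F\in\mathbb R[u,v,t]: F(u,v,t)=F(v,u,t),\ \deg_{(u,t)}F\le d,\ \deg_tF\le d\},$$ where $\deg_{(u,t)}$ is the total degree in the variables $u,t$. Call $F\in\mathbb R[u,v,t]$ positive definite if, for all finite $C\subset S^{n-1}$ and all $\alpha:C\to\mathbb R$, $$\sum_{(c,c')\in C^2}\alpha(c)\alpha(c')\,F(e\cdot c,\,e\cdot c',\,c\cdot c')\ \ge\ 0.$$ Let $F\in R_d$. (1) Let $F_0,\dots,F_d$ be real symmetric matrices, $F_k$ of size $(d-k+1)\times(d-k+1)$, such that $F=\sum_{k=0}^d\langle F_k,\overline Y_k^n\rangle$. If $F$ is positive definite, then $F_k$ is positive semidefinite for all $0\le k\le d$. (2) $F$ is positive definite if and only if there are positive semidefinite (real symmetric) matrices $F_0,\dots,F_d$ of these sizes with $F=\sum_{k=0}^d\langle F_k,\overline Y_k^n\rangle$. -/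

import Mathlib

namespace ZonalMatrix

noncomputable section

open MeasureTheory

/-! ### Zonal polynomials of the sphere -/

/-- The Gegenbauer polynomials `C_k^a` with parameter `a`, by their three-term recurrence
`(k + 2) C_{k+2} = 2 (k + 1 + a) x C_{k+1} - (k + 2 a) C_k`, `C_0 = 1`, `C_1 = 2 a x`. -/
def gegenbauer (a : ℝ) : ℕ → Polynomial ℝ
  | 0 => 1
  | 1 => Polynomial.C (2 * a) * Polynomial.X
  | k + 2 =>
      Polynomial.C (2 * ((k : ℝ) + 1 + a) / ((k : ℝ) + 2)) * Polynomial.X * gegenbauer a (k + 1)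
        - Polynomial.C (((k : ℝ) + 2 * a) / ((k : ℝ) + 2)) * gegenbauer a k

/-- The zonal polynomial `P_k^n` of the unit sphere of `ℝ^n` (`n ≥ 2`): the Chebyshev polynomial of
the first kind if `n = 2`, and for `n ≥ 3` the Gegenbauer polynomial with parameter `n / 2 - 1`
normalized to take the value `1` at `1`. -/
def zonal (n k : ℕ) : Polynomial ℝ :=
  if n = 2 then Polynomial.Chebyshev.T ℝ (k : ℤ)
  else Polynomial.C ((gegenbauer ((n : ℝ) / 2 - 1) k).eval 1)⁻¹ * gegenbauer ((n : ℝ) / 2 - 1) k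

/-! ### Harmonic polynomials and surface areas -/

/-- `Harm_k^n`: the real homogeneous polynomials of degree `k` in `n` variables that are killed by
the Laplace operator. -/
def harm (n k : ℕ) : Submodule ℝ (MvPolynomial (Fin n) ℝ) :=
  MvPolynomial.homogeneousSubmodule (Fin n) ℝ k ⊓
    LinearMap.ker (∑ i : Fin n,
      (MvPolynomial.pderiv i : Derivation ℝ _ (MvPolynomial (Fin n) ℝ)).toLinearMap ∘ₗ
        (MvPolynomial.pderiv i : Derivation ℝ _ (MvPolynomial (Fin n) ℝ)).toLinearMap)

/-- `h_k^n = dim Harm_k^n`. -/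
def harmDim (n k : ℕ) : ℕ := Module.finrank ℝ (harm n k)

/-- `ω_n`: the surface area of the unit sphere of `ℝ^n`. -/
def sphereArea (n : ℕ) : ℝ :=
  (volume : Measure (EuclideanSpace ℝ (Fin n))).toSphere.real Set.univ

/-! ### The zonal matrices, as matrices of polynomials in `u`, `v`, `t` -/

/-- Real polynomials in the three variables `u`, `v`, `t`. -/
abbrev Poly3 : Type := MvPolynomial (Fin 3) ℝ

/-- The variable `u`. -/
def U : Poly3 := MvPolynomial.X 0

/-- The variable `v`. -/
def V : Poly3 := MvPolynomial.X 1

/-- The variable `t`. -/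
def T : Poly3 := MvPolynomial.X 2

/-- The polynomial `((1-u²)(1-v²))^{k/2} P_k^m ((t-uv) / √((1-u²)(1-v²)))`, written out through the
coefficients of `P_k^m`. Only exponents `j ≤ k` with `k - j` even occur in `P_k^m`, so the natural
number division is exact wherever the coefficient is not zero (see `eval_Q`). -/
def Q (m k : ℕ) : Poly3 :=
  ∑ j ∈ Finset.range (k + 1),
    MvPolynomial.C ((zonal m k).coeff j) * (T - U * V) ^ j *
      ((1 - U ^ 2) * (1 - V ^ 2)) ^ ((k - j) / 2)

/-- `λ_{i,j} = (ω_n / ω_{n-1}) (ω_{n+2k-1} / ω_{n+2k}) (h_i^{n+2k} h_j^{n+2k})^{1/2}`. -/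
def lam (n k i j : ℕ) : ℝ :=
  sphereArea n / sphereArea (n - 1) * (sphereArea (n + 2 * k - 1) / sphereArea (n + 2 * k)) *
    Real.sqrt ((harmDim (n + 2 * k) i : ℝ) * (harmDim (n + 2 * k) j : ℝ))

/-- The matrix `Y_k^n` of size `d - k + 1`, with entries
`λ_{i,j} P_i^{n+2k}(u) P_j^{n+2k}(v) Q_k^{n-1}(u,v,t)`. -/
def Y (n d k : ℕ) : Matrix (Fin (d - k + 1)) (Fin (d - k + 1)) Poly3 :=
  Matrix.of fun i j =>
    MvPolynomial.C (lam n k i j) * Polynomial.aeval U (zonal (n + 2 * k) i) *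
      Polynomial.aeval V (zonal (n + 2 * k) j) * Q (n - 1) k

/-- The exchange `F(u,v,t) ↦ F(v,u,t)`. -/
def swapUV (F : Poly3) : Poly3 := MvPolynomial.rename (Equiv.swap (0 : Fin 3) 1) F

/-- The symmetrized matrix `½ (Y_k^n(u,v,t) + Y_k^n(v,u,t))`. -/
def Ybar (n d k : ℕ) : Matrix (Fin (d - k + 1)) (Fin (d - k + 1)) Poly3 :=
  Matrix.of fun i j => MvPolynomial.C (1 / 2 : ℝ) * (Y n d k i j + swapUV (Y n d k i j))

/-- `⟨A, B⟩ = Trace (A Bᵗ)` for a real matrix `A` and a matrix `B` of polynomials. -/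
def pairing {m : ℕ} (A : Matrix (Fin m) (Fin m) ℝ) (B : Matrix (Fin m) (Fin m) Poly3) : Poly3 :=
  (A.map MvPolynomial.C * B.transpose).trace

/-- The polynomial `∑_{k=0}^d ⟨F_k, Ybar_k^n⟩` with matrix coefficients `(F_0, …, F_d)`. -/
def expansion (n d : ℕ)
    (A : (k : Fin (d + 1)) → Matrix (Fin (d - k + 1)) (Fin (d - k + 1)) ℝ) : Poly3 :=
  ∑ k : Fin (d + 1), pairing (A k) (Ybar n d k)

/-! ### The space `R_d` and positive definite polynomials -/

/-- `R_d`: polynomials symmetric in `u`, `v`, of total degree at most `d` in `(u, t)` and of degree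
at most `d` in `t`. -/
def R (d : ℕ) : Set Poly3 :=
  {F | swapUV F = F ∧ MvPolynomial.weightedTotalDegree (![1, 0, 1] : Fin 3 → ℕ) F ≤ d ∧
    MvPolynomial.degreeOf 2 F ≤ d}

/-- `F` is positive definite with respect to the point `e` of the unit sphere of `ℝ^n`. -/
def IsPosDef {n : ℕ} (e : Metric.sphere (0 : EuclideanSpace ℝ (Fin n)) 1) (F : Poly3) : Prop :=
  ∀ (C : Finset (Metric.sphere (0 : EuclideanSpace ℝ (Fin n)) 1))
    (α : Metric.sphere (0 : EuclideanSpace ℝ (Fin n)) 1 → ℝ),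
    0 ≤ ∑ c ∈ C, ∑ c' ∈ C, α c * α c' *
      MvPolynomial.eval ![inner ℝ e.1 c.1, inner ℝ e.1 c'.1, inner ℝ c.1 c'.1] F

/-! ### The defining formula of `Q` -/

theorem gegenbauer_coeff (a : ℝ) (k : ℕ) :
    ∀ j, (gegenbauer a k).coeff j ≠ 0 → ∃ i, j + 2 * i = k := by
  induction k using Nat.strong_induction_on with
  | _ k ih =>
    match k, ih with
    | 0, _ =>
      intro j hj
      refine ⟨0, ?_⟩
      by_contra h
      exact hj (by simp [gegenbauer, Polynomial.coeff_one]; omega)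
    | 1, _ =>
      intro j hj
      refine ⟨0, ?_⟩
      by_contra h
      exact hj (by rw [gegenbauer, Polynomial.coeff_C_mul, Polynomial.coeff_X_of_ne_one (by omega), mul_zero])
    | k + 2, ih =>
      intro j hj
      by_contra h
      push Not at h
      apply hj
      have h0 : (gegenbauer a k).coeff j = 0 := by
        by_contra hc
        obtain ⟨i, hi⟩ := ih k (by omega) j hc
        exact h (i + 1) (by omega)
      rw [gegenbauer, Polynomial.coeff_sub, Polynomial.coeff_C_mul, h0, mul_assoc,
        Polynomial.coeff_C_mul]
      cases j with
      | zero => simp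
      | succ j =>
        have h1 : (gegenbauer a (k + 1)).coeff j = 0 := by
          by_contra hc
          obtain ⟨i, hi⟩ := ih (k + 1) (by omega) j hc
          exact h i (by omega)
        simp [Polynomial.coeff_X_mul, h1]

theorem chebyshev_coeff (k : ℕ) :
    ∀ j, (Polynomial.Chebyshev.T ℝ (k : ℤ)).coeff j ≠ 0 → ∃ i, j + 2 * i = k := by
  induction k using Nat.strong_induction_on with
  | _ k ih =>
    match k, ih with
    | 0, _ =>
      intro j hj
      refine ⟨0, ?_⟩
      by_contra h
      exact hj (by simp [Polynomial.coeff_one]; omega)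
    | 1, _ =>
      intro j hj
      refine ⟨0, ?_⟩
      by_contra h
      exact hj (by simp [Polynomial.coeff_X]; omega)
    | k + 2, ih =>
      intro j hj
      by_contra h
      push Not at h
      apply hj
      have h0 : (Polynomial.Chebyshev.T ℝ (k : ℤ)).coeff j = 0 := by
        by_contra hc
        obtain ⟨i, hi⟩ := ih k (by omega) j hc
        exact h (i + 1) (by omega)
      have e2 : Polynomial.Chebyshev.T ℝ ((k + 2 : ℕ) : ℤ) =
          Polynomial.C 2 * (Polynomial.X * Polynomial.Chebyshev.T ℝ ((k + 1 : ℕ) : ℤ)) -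
            Polynomial.Chebyshev.T ℝ (k : ℤ) := by
        push_cast
        rw [Polynomial.Chebyshev.T_add_two, mul_assoc]
        rfl
      rw [e2, Polynomial.coeff_sub, h0, Polynomial.coeff_C_mul]
      cases j with
      | zero => simp
      | succ j =>
        have h1 : (Polynomial.Chebyshev.T ℝ ((k + 1 : ℕ) : ℤ)).coeff j = 0 := by
          by_contra hc
          obtain ⟨i, hi⟩ := ih (k + 1) (by omega) j hc
          exact h i (by omega)
        rw [Polynomial.coeff_X_mul, h1]
        simp

theorem zonal_coeff (m k j : ℕ) (h : (zonal m k).coeff j ≠ 0) : ∃ i, j + 2 * i = k := by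
  unfold zonal at h
  split_ifs at h
  · exact chebyshev_coeff k j h
  · rw [Polynomial.coeff_C_mul] at h
    exact gegenbauer_coeff _ k j (right_ne_zero_of_mul h)

/-- `Q m k` has the values prescribed by its defining formula. -/
theorem eval_Q (m k : ℕ) (u v t : ℝ) (hu : |u| < 1) (hv : |v| < 1) :
    MvPolynomial.eval ![u, v, t] (Q m k) =
      ((1 - u ^ 2) * (1 - v ^ 2)) ^ ((k : ℝ) / 2) *
        (zonal m k).eval ((t - u * v) / Real.sqrt ((1 - u ^ 2) * (1 - v ^ 2))) := by
  have hw : 0 < (1 - u ^ 2) * (1 - v ^ 2) :=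
    mul_pos (by rw [← sq_abs]; nlinarith [abs_nonneg u]) (by rw [← sq_abs]; nlinarith [abs_nonneg v])
  set w := (1 - u ^ 2) * (1 - v ^ 2) with hwdef
  have hs : 0 < Real.sqrt w := Real.sqrt_pos.2 hw
  have hss : Real.sqrt w ^ 2 = w := Real.sq_sqrt hw.le
  have hpow : w ^ ((k : ℝ) / 2) = Real.sqrt w ^ k := by
    rw [Real.sqrt_eq_rpow, ← Real.rpow_natCast, ← Real.rpow_mul hw.le]
    congr 1
    ring
  have hdeg : (zonal m k).natDegree < k + 1 := by
    rw [Nat.lt_succ_iff, Polynomial.natDegree_le_iff_coeff_eq_zero]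
    intro j hj
    by_contra hc
    obtain ⟨i, hi⟩ := zonal_coeff m k j hc
    omega
  rw [hpow, Polynomial.eval_eq_sum_range' hdeg, Finset.mul_sum]
  unfold Q
  rw [map_sum]
  refine Finset.sum_congr rfl fun j _ => ?_
  by_cases hc : (zonal m k).coeff j = 0
  · simp [hc]
  · obtain ⟨i, hi⟩ := zonal_coeff m k j hc
    have hk : (k - j) / 2 = i := by omega
    simp only [map_mul, map_pow, map_sub, map_one, MvPolynomial.eval_C, U, V, T,
      MvPolynomial.eval_X, hk]
    simp only [Matrix.cons_val_zero, Matrix.cons_val_one, Matrix.cons_val]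
    rw [← hwdef, ← hi, pow_add, pow_mul, hss, div_pow]
    field_simp

end

end ZonalMatrix

namespace ZonalMatrix

noncomputable section

open MvPolynomial

/-! ### The Fischer form -/

section Fischer

variable {σ : Type*} [Fintype σ]

/-! Write `n = m + 1` and split a point of the sphere as `c = u e + x` with `x` in the
`m`-dimensional complement of `e`, so that `|x|² = 1 - u²`. For `c' = v e + y` one has `c·c' - uv =
x·y`, and `Q m k` takes the value `|x|^k |y|^k P_k^m(cos ∠(x,y))`. By the reproducing property of
zonal harmonics this is a positive constant times `⟨Z_x, Z_y⟩`, where `Z_x` is the harmonic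
polynomial `zonalHarm x k` and the form is the Fischer form (`zonalForm_eq_fischer`). The Fischer
form is positive definite and makes the Laplacian adjoint to multiplication by `|X|²`, so no
integration over the sphere is needed.

Since `λ_{i,j}` is a positive constant times `√h_i √h_j`, the quadratic form of the kernel with
weights `α` is a positive combination over `k` of `∑_{i,j} (F_k)_{i,j} ⟨Φ_{k,i}, Φ_{k,j}⟩`, with
`Φ_{k,i} = √h_i ∑_c α(c) P_i(u_c) Z_{x_c}` (`sum_eval_rawExpansion`). If every `F_k` is positive
semidefinite, each summand is nonnegative (`sum_mul_fischer_nonneg`).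

Conversely, the families `(P_i(u) Z_x)_{k,i}` span the whole product of harmonic spaces
(`span_zonalVector`). Hence `α` can be chosen with `Φ_{k,i} = w_i p` for one `k`, with `p ≠ 0`
fixed, and zero in every other block. The form then equals a positive multiple of `wᵗ F_k w`.

It remains that every element of `R_d` has an expansion with symmetric coefficients
(`exists_expansion`), which follows from the recurrence of the `Q m k` and the symmetry in `u`, `v`.
-/

/-- The Fischer form on polynomials: monomials are orthogonal and `X^μ` has square norm `μ!`. -/
def fischer : MvPolynomial σ ℝ →ₗ[ℝ] MvPolynomial σ ℝ →ₗ[ℝ] ℝ :=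
  (basisMonomials σ ℝ).constr ℝ fun μ => (∏ i, ((μ i).factorial : ℝ)) • lcoeff ℝ μ

theorem fischer_monomial (μ : σ →₀ ℕ) (a : ℝ) (q : MvPolynomial σ ℝ) :
    fischer (monomial μ a) q = a * (∏ i, ((μ i).factorial : ℝ)) * coeff μ q := by
  have h : (monomial μ a : MvPolynomial σ ℝ) = a • basisMonomials σ ℝ μ := by
    simp [coe_basisMonomials, smul_monomial]
  rw [h, map_smul, fischer, Module.Basis.constr_basis]
  simp [lcoeff, mul_assoc]

theorem fischer_comm (p q : MvPolynomial σ ℝ) : fischer p q = fischer q p := by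
  induction p using MvPolynomial.induction_on' with
  | add p p' hp hp' => simp only [map_add, LinearMap.add_apply, hp, hp']
  | monomial μ a =>
    induction q using MvPolynomial.induction_on' with
    | add p p' hp hp' => simp only [map_add, LinearMap.add_apply, hp, hp']
    | monomial ν b =>
      classical
      rw [fischer_monomial, fischer_monomial, coeff_monomial, coeff_monomial]
      by_cases h : μ = ν
      · subst h; simp; ring
      · rw [if_neg h, if_neg (Ne.symm h)]; simp

theorem fischer_self (p : MvPolynomial σ ℝ) :
    fischer p p = ∑ μ ∈ p.support, (∏ i, ((μ i).factorial : ℝ)) * coeff μ p ^ 2 := by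
  conv_lhs => enter [1, 2]; rw [p.as_sum]
  rw [map_sum, LinearMap.sum_apply]
  refine Finset.sum_congr rfl fun μ _ => ?_
  rw [fischer_monomial]; ring

theorem fischer_self_nonneg (p : MvPolynomial σ ℝ) : 0 ≤ fischer p p := by
  rw [fischer_self]
  exact Finset.sum_nonneg fun μ _ => by positivity

theorem fischer_self_pos {p : MvPolynomial σ ℝ} (hp : p ≠ 0) : 0 < fischer p p := by
  rw [fischer_self]
  refine Finset.sum_pos (fun μ hμ => ?_) (support_nonempty.2 hp)
  have := mem_support_iff.1 hμ
  positivity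

theorem fischer_pderiv (i : σ) (p q : MvPolynomial σ ℝ) :
    fischer (pderiv i p) q = fischer p (X i * q) := by
  classical
  induction p using MvPolynomial.induction_on' with
  | add p p' hp hp' => simp only [map_add, LinearMap.add_apply, hp, hp']
  | monomial μ a =>
    rw [pderiv_monomial, fischer_monomial, fischer_monomial, coeff_X_mul']
    by_cases h : μ i = 0
    · simp [h]
    · rw [if_pos (by simpa using h), ← Finset.mul_prod_erase _ _ (Finset.mem_univ i),
        ← Finset.mul_prod_erase _ (fun j => ((μ j).factorial : ℝ)) (Finset.mem_univ i)]
      have h1 : ∀ j ∈ Finset.univ.erase i,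
          (((μ - Finsupp.single i 1 : σ →₀ ℕ) j).factorial : ℝ) = ((μ j).factorial : ℝ) := by
        intro j hj
        simp [(Finset.ne_of_mem_erase hj).symm]
      rw [Finset.prod_congr rfl h1]
      obtain ⟨k, hk⟩ := Nat.exists_eq_succ_of_ne_zero h
      simp only [Finsupp.tsub_apply, hk, Finsupp.single_eq_same, Nat.succ_sub_one,
        Nat.factorial_succ]
      push_cast
      ring

/-- The quadratic form `∑ X_i²`. -/
def normSq (σ : Type*) [Fintype σ] : MvPolynomial σ ℝ := ∑ i, X i ^ 2

/-- The Laplace operator. -/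
def laplacian : MvPolynomial σ ℝ →ₗ[ℝ] MvPolynomial σ ℝ :=
  ∑ i, (pderiv i : Derivation ℝ (MvPolynomial σ ℝ) _).toLinearMap ∘ₗ
    (pderiv i : Derivation ℝ (MvPolynomial σ ℝ) _).toLinearMap

theorem laplacian_apply (p : MvPolynomial σ ℝ) :
    laplacian p = ∑ i, pderiv i (pderiv i p) := by
  simp [laplacian]

/-- Consequently harmonic polynomials are orthogonal to all multiples of `normSq`; both the
reproducing property and the independence on the sphere rest on this. -/
theorem fischer_laplacian (p q : MvPolynomial σ ℝ) :
    fischer (laplacian p) q = fischer p (normSq σ * q) := by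
  rw [laplacian_apply, map_sum, LinearMap.sum_apply, normSq, Finset.sum_mul, map_sum]
  refine Finset.sum_congr rfl fun i _ => ?_
  rw [fischer_pderiv, fischer_pderiv, sq, mul_assoc]

/-- The linear form `∑ y_i X_i`. -/
def linForm (y : σ → ℝ) : MvPolynomial σ ℝ := ∑ i, C (y i) * X i

/-- By adjointness each factor `linForm y` becomes a derivative along `y`, and Euler's identity
evaluates it at `y`. -/
theorem fischer_linForm_pow (y : σ → ℝ) (k : ℕ) :
    ∀ p : MvPolynomial σ ℝ, p.IsHomogeneous k →
      fischer p (linForm y ^ k) = k.factorial * eval y p := by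
  induction k with
  | zero =>
    intro p hp
    rw [← totalDegree_zero_iff_isHomogeneous, totalDegree_eq_zero_iff_eq_C] at hp
    rw [hp, pow_zero, eval_C]
    rw [C_apply, fischer_monomial]
    simp
  | succ k ih =>
    intro p hp
    have euler := congrArg (eval y) hp.sum_X_mul_pderiv
    simp only [map_sum, map_mul, eval_X, nsmul_eq_mul, map_natCast] at euler
    rw [pow_succ', linForm, Finset.sum_mul, map_sum]
    have h1 : ∀ i, fischer p (C (y i) * X i * linForm y ^ k) =
        k.factorial * (y i * eval y (pderiv i p)) := by
      intro i
      rw [mul_assoc, C_mul', map_smul, ← fischer_pderiv, ih _ (by simpa using hp.pderiv (i := i))]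
      simp; ring
    simp only [linForm] at h1 ⊢
    rw [Finset.sum_congr rfl fun i _ => h1 i, ← Finset.mul_sum, euler, Nat.factorial_succ]
    push_cast
    ring

end Fischer

/-! ### The three-term recurrence of the zonal polynomials -/

section ZonalForm

variable {A : Type*} [CommRing A] [Algebra ℝ A]

/-- The homogenized zonal polynomial: `‖x‖^k ‖y‖^k P_k^m (x·y / (‖x‖ ‖y‖))` as a function of
`s = x·y` and `r = ‖x‖² ‖y‖²`. -/
def zonalForm (m : ℕ) (s r : A) : ℕ → A
  | 0 => 1
  | 1 => s
  | k + 2 => algebraMap ℝ A ((k + m - 1 : ℝ)⁻¹) *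
      ((2 * k + m) * s * zonalForm m s r (k + 1) - (k + 1) * r * zonalForm m s r k)

/-- Naturality lets a single recurrence serve univariate polynomials, polynomials in `U`, `V`, `T`,
harmonic polynomials and real values. -/
theorem map_zonalForm {B : Type*} [CommRing B] [Algebra ℝ B] (f : A →ₐ[ℝ] B) (m : ℕ) (s r : A)
    (k : ℕ) : f (zonalForm m s r k) = zonalForm m (f s) (f r) k := by
  induction k using Nat.twoStepInduction with
  | zero => simp [zonalForm]
  | one => simp [zonalForm]
  | more k h0 h1 => simp [zonalForm, h0, h1, AlgHom.commutes, map_ofNat f 2]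

theorem natCast_add_sub_one_pos {m : ℕ} (hm : 2 ≤ m) (k : ℕ) : (0 : ℝ) < k + m - 1 := by
  have : (2 : ℝ) ≤ m := by exact_mod_cast hm
  have : (0 : ℝ) ≤ k := by positivity
  linarith

theorem isUnit_natCast_add_sub_one {m : ℕ} (hm : 2 ≤ m) (k : ℕ) : IsUnit ((k : A) + m - 1) := by
  have h := (IsUnit.mk0 _ (natCast_add_sub_one_pos hm k).ne').map (algebraMap ℝ A)
  simpa using h

theorem zonalForm_recurrence {m : ℕ} (hm : 2 ≤ m) (s r : A) (k : ℕ) :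
    ((k : A) + m - 1) * zonalForm m s r (k + 2) =
      (2 * k + m) * s * zonalForm m s r (k + 1) - (k + 1) * r * zonalForm m s r k := by
  have h : ((k : A) + m - 1) * algebraMap ℝ A ((k + m - 1 : ℝ)⁻¹) = 1 := by
    have h1 : ((k : A) + m - 1) = algebraMap ℝ A (k + m - 1 : ℝ) := by simp
    rw [h1, ← map_mul, mul_inv_cancel₀ (natCast_add_sub_one_pos hm k).ne', map_one]
  rw [zonalForm, ← mul_assoc, h, one_mul]

theorem zonalForm_one_one {m : ℕ} (hm : 2 ≤ m) (k : ℕ) : zonalForm m (1 : ℝ) 1 k = 1 := by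
  induction k using Nat.twoStepInduction with
  | zero => simp [zonalForm]
  | one => simp [zonalForm]
  | more k h0 h1 =>
    have h := zonalForm_recurrence hm (1 : ℝ) 1 k
    rw [h0, h1] at h
    have := natCast_add_sub_one_pos hm k
    apply mul_left_cancel₀ this.ne'
    rw [h]; ring

theorem derivation_zonalForm_recurrence {m : ℕ} (hm : 2 ≤ m) (D : Derivation ℝ A A) (s r : A)
    (k : ℕ) : ((k : A) + m - 1) * D (zonalForm m s r (k + 2)) =
      (2 * k + m) * (D s * zonalForm m s r (k + 1) + s * D (zonalForm m s r (k + 1))) -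
        (k + 1) * (D r * zonalForm m s r k + r * D (zonalForm m s r k)) := by
  have hD := congrArg D (zonalForm_recurrence hm s r k)
  have h2 : D (2 : A) = 0 := by exact_mod_cast D.map_natCast 2
  simp only [Derivation.leibniz, map_sub, map_add, Derivation.map_natCast, h2, smul_eq_mul,
    Derivation.map_one_eq_zero] at hD
  linear_combination hD

/-- The model is `D = ∂_y`, `s = x·y`, `r = |x|²|y|²`, `N = |y|²`: differentiating a zonal harmonic
towards its pole lowers the degree by one. -/
theorem derivation_zonalForm {m : ℕ} (hm : 2 ≤ m) (D : Derivation ℝ A A) {s r N : A}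
    (hs : D s = N) (hr : D r = 2 * N * s) (k : ℕ) :
    D (zonalForm m s r (k + 1)) = (k + 1) * N * zonalForm m s r k := by
  induction k using Nat.twoStepInduction with
  | zero => simp [zonalForm, hs]
  | one =>
    have hD := derivation_zonalForm_recurrence hm D s r 0
    apply (isUnit_natCast_add_sub_one (A := A) hm 0).mul_left_cancel
    rw [hs, hr] at hD
    simp only [show zonalForm m s r 0 = 1 from rfl, show zonalForm m s r (0 + 1) = s from rfl,
      hs, Derivation.map_one_eq_zero] at hD ⊢
    push_cast at hD ⊢
    linear_combination hD
  | more k h0 h1 =>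
    have hD := derivation_zonalForm_recurrence hm D s r (k + 1)
    have hK := zonalForm_recurrence hm s r k
    apply (isUnit_natCast_add_sub_one (A := A) hm (k + 1)).mul_left_cancel
    rw [h0, h1, hs, hr] at hD
    push_cast at hD ⊢
    linear_combination hD - N * (k + 2) * hK

/-- The coefficient of `s^k` in `zonalForm m s r k`. -/
def zonalLead (m : ℕ) : ℕ → ℝ
  | 0 => 1
  | 1 => 1
  | k + 2 => (2 * k + m) / (k + m - 1) * zonalLead m (k + 1)

theorem zonalLead_pos {m : ℕ} (hm : 2 ≤ m) (k : ℕ) : 0 < zonalLead m k := by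
  induction k using Nat.twoStepInduction with
  | zero => simp [zonalLead]
  | one => simp [zonalLead]
  | more k h0 h1 =>
    have := natCast_add_sub_one_pos hm k
    have : (0 : ℝ) < m := by positivity
    rw [zonalLead]; positivity

/-- For zonal harmonics `r` is a multiple of `normSq`, so only the leading power of `s` pairs
nontrivially with a harmonic polynomial. -/
theorem zonalForm_eq_lead (m : ℕ) (s r : A) (k : ℕ) :
    ∃ q, zonalForm m s r k = algebraMap ℝ A (zonalLead m k) * s ^ k + r * q := by
  induction k using Nat.twoStepInduction with
  | zero => exact ⟨0, by simp [zonalForm, zonalLead]⟩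
  | one => exact ⟨0, by simp [zonalForm, zonalLead]⟩
  | more k h0 h1 =>
    obtain ⟨q, hq⟩ := h1
    refine ⟨algebraMap ℝ A ((k + m - 1 : ℝ)⁻¹) * ((2 * k + m) * s * q -
      (k + 1) * zonalForm m s r k), ?_⟩
    rw [zonalForm, hq, zonalLead, div_eq_mul_inv]
    simp only [map_mul, map_add, map_natCast, map_ofNat]
    ring

end ZonalForm

/-! ### Agreement of `zonal` and `Q` with the common recurrence -/

section ZonalForm

variable {A : Type*} [CommRing A] [Algebra ℝ A]

theorem zonalForm_add_two (m : ℕ) (s r : A) (k : ℕ) :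
    zonalForm m s r (k + 2) = ((2 * k + m) / (k + m - 1) : ℝ) • (s * zonalForm m s r (k + 1)) -
      ((k + 1) / (k + m - 1) : ℝ) • (r * zonalForm m s r k) := by
  rw [zonalForm, div_eq_mul_inv, div_eq_mul_inv, Algebra.smul_def, Algebra.smul_def]
  simp only [map_mul, map_add, map_natCast, map_ofNat, map_one]
  ring

theorem gegenbauer_eval_one_succ {a : ℝ} (k : ℕ) :
    (k + 1) * (gegenbauer a (k + 1)).eval 1 = (k + 2 * a) * (gegenbauer a k).eval 1 := by
  induction k with
  | zero => simp [gegenbauer]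
  | succ k ih =>
    have h : (gegenbauer a (k + 1 + 1)).eval 1 = 2 * ((k : ℝ) + 1 + a) / ((k : ℝ) + 2) *
        (gegenbauer a (k + 1)).eval 1 - ((k : ℝ) + 2 * a) / ((k : ℝ) + 2) *
        (gegenbauer a k).eval 1 := by
      rw [gegenbauer]; simp
    have hk : (k : ℝ) + 2 ≠ 0 := by positivity
    rw [h]
    push_cast
    field_simp
    linear_combination (k + 2 : ℝ) * ih

theorem gegenbauer_eval_one_pos {a : ℝ} (ha : 0 < a) (k : ℕ) : 0 < (gegenbauer a k).eval 1 := by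
  induction k with
  | zero => simp [gegenbauer]
  | succ k ih =>
    have h := gegenbauer_eval_one_succ (a := a) k
    have : (0 : ℝ) < (k + 1) * (gegenbauer a (k + 1)).eval 1 := by rw [h]; positivity
    exact pos_of_mul_pos_right this (by positivity)

/-- Dividing the Gegenbauer recurrence by the values at `1`, whose ratios are known, gives a
recurrence that at `m = 2` is Chebyshev's. From here on the two cases are uniform. -/
theorem zonal_eq_zonalForm {m : ℕ} (hm : 2 ≤ m) (k : ℕ) :
    zonal m k = zonalForm m Polynomial.X 1 k := by
  by_cases h2 : m = 2
  · subst h2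
    simp only [zonal, if_true]
    induction k using Nat.twoStepInduction with
    | zero => simp [zonalForm]
    | one => simp [zonalForm]
    | more k h0 h1 =>
      apply (isUnit_natCast_add_sub_one (A := Polynomial ℝ) hm k).mul_left_cancel
      rw [zonalForm_recurrence hm, ← h0, ← h1]
      push_cast
      rw [Polynomial.Chebyshev.T_add_two]
      ring
  · have ha : (0 : ℝ) < (m : ℝ) / 2 - 1 := by
      have : (3 : ℝ) ≤ m := by exact_mod_cast (by omega : 3 ≤ m)
      linarith
    simp only [zonal, if_neg h2]
    induction k using Nat.twoStepInduction with
    | zero => simp [zonalForm, gegenbauer]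
    | one =>
      simp only [zonalForm, gegenbauer]
      rw [← mul_assoc, ← Polynomial.C_mul]
      simp only [Polynomial.eval_mul, Polynomial.eval_C, Polynomial.eval_X, mul_one]
      rw [inv_mul_cancel₀ (by positivity), Polynomial.C_1, one_mul]
    | more k h0 h1 =>
      have hG : gegenbauer ((m : ℝ) / 2 - 1) (k + 2) =
          Polynomial.C (2 * ((k : ℝ) + 1 + ((m : ℝ) / 2 - 1)) / ((k : ℝ) + 2)) * Polynomial.X *
            gegenbauer ((m : ℝ) / 2 - 1) (k + 1) -
          Polynomial.C (((k : ℝ) + 2 * ((m : ℝ) / 2 - 1)) / ((k : ℝ) + 2)) *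
            gegenbauer ((m : ℝ) / 2 - 1) k := by rw [gegenbauer]
      have e1 := gegenbauer_eval_one_succ (a := (m : ℝ) / 2 - 1) k
      have e2 := gegenbauer_eval_one_succ (a := (m : ℝ) / 2 - 1) (k + 1)
      have p0 := gegenbauer_eval_one_pos ha k
      have p1 := gegenbauer_eval_one_pos ha (k + 1)
      rw [zonalForm_add_two, ← h0, ← h1]
      have hk := natCast_add_sub_one_pos hm k
      have hq : (k : ℝ) + 2 * ((m : ℝ) / 2 - 1) ≠ 0 := by positivity
      generalize (gegenbauer ((m : ℝ) / 2 - 1) k).eval 1 = b0 at *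
      generalize (gegenbauer ((m : ℝ) / 2 - 1) (k + 1)).eval 1 = b1 at *
      generalize (gegenbauer ((m : ℝ) / 2 - 1) (k + 2)).eval 1 = b2 at *
      have hb1 : b1 = (k + 2 * ((m : ℝ) / 2 - 1)) / (k + 1) * b0 := by
        field_simp; linear_combination e1
      have hb2 : b2 = (k + m - 1) / (k + 2) * b1 := by
        push_cast at e2
        field_simp; linear_combination e2
      have c1 : b2⁻¹ * (2 * ((k : ℝ) + 1 + ((m : ℝ) / 2 - 1)) / ((k : ℝ) + 2)) =
          (2 * k + m) / (k + m - 1) * b1⁻¹ := by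
        rw [hb2]; field_simp; ring
      have c2 : b2⁻¹ * (((k : ℝ) + 2 * ((m : ℝ) / 2 - 1)) / ((k : ℝ) + 2)) =
          (k + 1) / (k + m - 1) * b0⁻¹ := by
        rw [hb2, hb1]
        generalize (k : ℝ) + 2 * ((m : ℝ) / 2 - 1) = z at hq
        field_simp
      rw [hG, Polynomial.smul_eq_C_mul, Polynomial.smul_eq_C_mul, mul_sub, ← mul_assoc,
        ← mul_assoc, ← mul_assoc, ← Polynomial.C_mul, ← Polynomial.C_mul, c1, c2, Polynomial.C_mul,
        Polynomial.C_mul]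
      ring

theorem zonal_coeff_eq_zero {m k j : ℕ} (h : k < j) : (zonal m k).coeff j = 0 := by
  by_contra hc
  obtain ⟨i, hi⟩ := zonal_coeff m k j hc
  omega

/-- The truncated halves cause no trouble: multiplying by `s` preserves `k - j`, and passing from
`k` to `k + 2` raises `(k - j) / 2` by one for either parity when `j ≤ k`. -/
theorem sum_zonal_coeff {m : ℕ} (hm : 2 ≤ m) (s r : A) (k : ℕ) :
    ∑ j ∈ Finset.range (k + 1),
      algebraMap ℝ A ((zonal m k).coeff j) * s ^ j * r ^ ((k - j) / 2) = zonalForm m s r k := by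
  induction k using Nat.twoStepInduction with
  | zero => simp [zonalForm, zonal_eq_zonalForm hm]
  | one => simp [zonalForm, zonal_eq_zonalForm hm, Polynomial.coeff_X]
  | more k h0 h1 =>
    rw [zonalForm_add_two, ← h0, ← h1]
    have hz : zonal m (k + 2) = ((2 * k + m) / (k + m - 1) : ℝ) •
        (Polynomial.X * zonal m (k + 1)) - ((k + 1) / (k + m - 1) : ℝ) • zonal m k := by
      simp only [zonal_eq_zonalForm hm]
      rw [zonalForm_add_two, one_mul]
    simp only [hz, Polynomial.coeff_sub, Polynomial.coeff_smul, smul_eq_mul, map_sub, map_mul,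
      sub_mul, Finset.sum_sub_distrib]
    congr 1
    · rw [Finset.sum_range_succ' _ (k + 2)]
      simp only [Polynomial.coeff_X_mul, Polynomial.coeff_X_mul_zero, map_zero, mul_zero, zero_mul,
        add_zero, Finset.mul_sum, Finset.smul_sum]
      refine Finset.sum_congr rfl fun j _ => ?_
      rw [show k + 2 - (j + 1) = k + 1 - j by omega, Algebra.smul_def]
      ring
    · rw [Finset.sum_range_succ, Finset.sum_range_succ, zonal_coeff_eq_zero (by omega),
        zonal_coeff_eq_zero (by omega)]
      simp only [map_zero, mul_zero, zero_mul, add_zero, Finset.mul_sum, Finset.smul_sum]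
      refine Finset.sum_congr rfl fun j hj => ?_
      have := Finset.mem_range.1 hj
      rw [show (k + 2 - j) / 2 = (k - j) / 2 + 1 by omega, Algebra.smul_def]
      ring

theorem Q_eq_zonalForm {m : ℕ} (hm : 2 ≤ m) (k : ℕ) :
    Q m k = zonalForm m (T - U * V) ((1 - U ^ 2) * (1 - V ^ 2)) k := by
  rw [← sum_zonal_coeff hm]
  rfl

theorem zonal_degree {m : ℕ} (hm : 2 ≤ m) (k : ℕ) : (zonal m k).degree = k := by
  have hlead : (zonal m k).coeff k = zonalLead m k := by
    rw [zonal_eq_zonalForm hm]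
    induction k using Nat.twoStepInduction with
    | zero => simp [zonalForm, zonalLead]
    | one => simp [zonalForm, zonalLead]
    | more k h0 h1 =>
      have : (zonalForm m (Polynomial.X : Polynomial ℝ) 1 k).coeff (k + 2) = 0 := by
        rw [← zonal_eq_zonalForm hm]; exact zonal_coeff_eq_zero (by omega)
      rw [zonalForm_add_two, Polynomial.coeff_sub, Polynomial.coeff_smul, Polynomial.coeff_X_mul,
        h1, Polynomial.coeff_smul, one_mul, this, zonalLead]
      simp
  refine Polynomial.degree_eq_of_le_of_coeff_ne_zero ?_ ?_
  · exact Polynomial.degree_le_iff_coeff_zero _ _ |>.2 fun j hj =>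
      zonal_coeff_eq_zero (by exact_mod_cast hj)
  · rw [hlead]; exact (zonalLead_pos hm k).ne'

end ZonalForm

/-! ### Zonal harmonics -/

section Harmonic

variable {m : ℕ}

theorem mem_harm {k : ℕ} {p : MvPolynomial (Fin m) ℝ} :
    p ∈ harm m k ↔ p.IsHomogeneous k ∧ laplacian p = 0 := by
  rw [harm, Submodule.mem_inf, mem_homogeneousSubmodule, LinearMap.mem_ker]
  rfl

/-- The zonal harmonic polynomial of degree `k` with pole `y`. -/
def zonalHarm (y : Fin m → ℝ) (k : ℕ) : MvPolynomial (Fin m) ℝ :=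
  zonalForm m (linForm y) (C (∑ i, y i ^ 2) * normSq (Fin m)) k

theorem linForm_isHomogeneous (y : Fin m → ℝ) : (linForm y).IsHomogeneous 1 :=
  IsHomogeneous.sum _ _ _ fun _ _ => isHomogeneous_C_mul_X _ _

theorem normSq_isHomogeneous : (normSq (Fin m)).IsHomogeneous 2 :=
  IsHomogeneous.sum _ _ _ fun i _ => isHomogeneous_X_pow i 2

theorem zonalHarm_isHomogeneous (y : Fin m → ℝ) (k : ℕ) : (zonalHarm y k).IsHomogeneous k := by
  unfold zonalHarm
  induction k using Nat.twoStepInduction with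
  | zero => exact isHomogeneous_one _ _
  | one => exact linForm_isHomogeneous y
  | more k h0 h1 =>
    rw [zonalForm_add_two, smul_eq_C_mul, smul_eq_C_mul]
    refine IsHomogeneous.sub ?_ ?_
    · have := (isHomogeneous_C (Fin m) ((2 * k + m) / (k + m - 1) : ℝ)).mul
        ((linForm_isHomogeneous y).mul h1)
      exact (show 0 + (1 + (k + 1)) = k + 2 by omega) ▸ this
    · have := (isHomogeneous_C (Fin m) ((k + 1) / (k + m - 1) : ℝ)).mul
        (((isHomogeneous_C (Fin m) (∑ i, y i ^ 2)).mul normSq_isHomogeneous).mul h0)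
      exact (show 0 + (0 + 2 + k) = k + 2 by omega) ▸ this

theorem laplacian_mul (p q : MvPolynomial (Fin m) ℝ) :
    laplacian (p * q) = laplacian p * q + p * laplacian q +
      2 * ∑ i, pderiv i p * pderiv i q := by
  simp only [laplacian_apply, Finset.sum_mul, Finset.mul_sum, ← Finset.sum_add_distrib]
  refine Finset.sum_congr rfl fun i _ => ?_
  simp only [Derivation.leibniz, map_add, smul_eq_mul]
  ring

theorem pderiv_linForm (y : Fin m → ℝ) (i : Fin m) : pderiv i (linForm y) = C (y i) := by
  classical
  simp [linForm, pderiv_X, Pi.single_apply]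

theorem pderiv_normSq (i : Fin m) : pderiv i (normSq (Fin m)) = 2 * X i := by
  classical
  simp [normSq, Derivation.leibniz_pow, pderiv_X, Pi.single_apply]

theorem laplacian_linForm (y : Fin m → ℝ) : laplacian (linForm y) = 0 := by
  simp [laplacian_apply, pderiv_linForm]

theorem laplacian_normSq : laplacian (normSq (Fin m)) = 2 * m := by
  have h (i : Fin m) : pderiv i (2 : MvPolynomial (Fin m) ℝ) = 0 := by
    exact_mod_cast (pderiv i).map_natCast 2
  simp [laplacian_apply, pderiv_normSq, Derivation.leibniz, h, mul_comm]

/-- The derivative in the direction `y`. -/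
def dirDeriv (y : Fin m → ℝ) : Derivation ℝ (MvPolynomial (Fin m) ℝ) (MvPolynomial (Fin m) ℝ) :=
  ∑ i, (C (y i) : MvPolynomial (Fin m) ℝ) •
    (pderiv i : Derivation ℝ (MvPolynomial (Fin m) ℝ) (MvPolynomial (Fin m) ℝ))

theorem dirDeriv_apply (y : Fin m → ℝ) (p : MvPolynomial (Fin m) ℝ) :
    dirDeriv y p = ∑ i, C (y i) * pderiv i p := by
  simp only [dirDeriv]
  rw [← Derivation.coeFnAddMonoidHom_apply, map_sum, Finset.sum_apply]
  simp

theorem dirDeriv_zonalHarm (hm : 2 ≤ m) (y : Fin m → ℝ) (k : ℕ) :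
    dirDeriv y (zonalHarm y (k + 1)) = ((k : MvPolynomial (Fin m) ℝ) + 1) * C (∑ i, y i ^ 2) * zonalHarm y k := by
  refine derivation_zonalForm hm _ ?_ ?_ k
  · simp [dirDeriv_apply, pderiv_linForm, sq]
  · have h : dirDeriv y (normSq (Fin m)) = 2 * linForm y := by
      simp only [dirDeriv_apply, pderiv_normSq, linForm, Finset.mul_sum]
      exact Finset.sum_congr rfl fun i _ => by ring
    have hC : dirDeriv y (C (∑ i, y i ^ 2)) = 0 := by
      rw [← algebraMap_eq]; exact Derivation.map_algebraMap _ _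
    rw [Derivation.leibniz, h, hC, smul_zero, add_zero, smul_eq_mul]
    ring

/-- In the recurrence, `Δ(linForm y · Z_{k+1}) = 2 ∂_y Z_{k+1} = 2(k+1)|y|² Z_k` and `Δ(normSq ·
Z_k) = (2m + 4k) Z_k`; the coefficients make the two contributions cancel. -/
theorem laplacian_zonalHarm (hm : 2 ≤ m) (y : Fin m → ℝ) (k : ℕ) :
    laplacian (zonalHarm y k) = 0 := by
  induction k using Nat.twoStepInduction with
  | zero => simp [zonalHarm, zonalForm, laplacian_apply]
  | one => simp [zonalHarm, zonalForm, laplacian_linForm]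
  | more k h0 h1 =>
    have hD := dirDeriv_zonalHarm hm y k
    have hE := (zonalHarm_isHomogeneous y k).sum_X_mul_pderiv
    rw [dirDeriv_apply] at hD
    have hL1 : laplacian (linForm y * zonalHarm y (k + 1)) =
        2 * (((k : MvPolynomial (Fin m) ℝ) + 1) * C (∑ i, y i ^ 2) * zonalHarm y k) := by
      rw [laplacian_mul, laplacian_linForm, h1]
      simp only [pderiv_linForm, hD]
      ring
    have hL2 : laplacian (normSq (Fin m) * zonalHarm y k) = (2 * m + 4 * k) * zonalHarm y k := by
      rw [laplacian_mul, laplacian_normSq, h0]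
      simp only [pderiv_normSq, mul_assoc, ← Finset.mul_sum, hE, nsmul_eq_mul]
      ring
    have hr : zonalHarm y (k + 2) = ((2 * k + m) / (k + m - 1) : ℝ) •
        (linForm y * zonalHarm y (k + 1)) - ((k + 1) / (k + m - 1) * (∑ i, y i ^ 2) : ℝ) •
        (normSq (Fin m) * zonalHarm y k) := by
      simp only [zonalHarm]
      rw [zonalForm_add_two, mul_smul, mul_assoc (C _), smul_eq_C_mul (normSq (Fin m) * _)]
    rw [hr, map_sub, map_smul, map_smul, hL1, hL2]
    simp only [smul_eq_C_mul, div_eq_mul_inv, map_mul, map_add, map_natCast, map_ofNat, map_one]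
    ring

theorem zonalHarm_mem (hm : 2 ≤ m) (y : Fin m → ℝ) (k : ℕ) : zonalHarm y k ∈ harm m k :=
  mem_harm.2 ⟨zonalHarm_isHomogeneous y k, laplacian_zonalHarm hm y k⟩

/-- The zonal harmonics reproduce the values of harmonic polynomials. -/
theorem fischer_zonalHarm {k : ℕ} {p : MvPolynomial (Fin m) ℝ} (hp : p ∈ harm m k)
    (y : Fin m → ℝ) : fischer p (zonalHarm y k) = zonalLead m k * k.factorial * eval y p := by
  obtain ⟨hh, hl⟩ := mem_harm.1 hp
  obtain ⟨q, hq⟩ := zonalForm_eq_lead m (linForm y) (C (∑ i, y i ^ 2) * normSq (Fin m)) k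
  rw [zonalHarm, hq, map_add, mul_assoc, mul_left_comm, ← fischer_laplacian, hl, map_zero,
    LinearMap.zero_apply, add_zero, algebraMap_eq, C_mul', map_smul, fischer_linForm_pow y k p hh,
    smul_eq_mul, mul_assoc]

theorem eval_zonalHarm (y z : Fin m → ℝ) (k : ℕ) :
    eval z (zonalHarm y k) =
      zonalForm m (∑ i, y i * z i) ((∑ i, y i ^ 2) * ∑ i, z i ^ 2) k := by
  have h := map_zonalForm (aeval z : MvPolynomial (Fin m) ℝ →ₐ[ℝ] ℝ) m (linForm y)
    (C (∑ i, y i ^ 2) * normSq (Fin m)) k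
  rw [zonalHarm, ← coe_aeval_eq_eval]
  refine h.trans ?_
  congr 1 <;> simp [linForm, normSq]

/-- The reproducing property applied to a zonal harmonic itself exhibits the kernel as a Gram
kernel. -/
theorem zonalForm_eq_fischer (hm : 2 ≤ m) (y z : Fin m → ℝ) (k : ℕ) :
    zonalForm m (∑ i, y i * z i) ((∑ i, y i ^ 2) * ∑ i, z i ^ 2) k =
      (zonalLead m k * k.factorial)⁻¹ * fischer (zonalHarm y k) (zonalHarm z k) := by
  rw [fischer_zonalHarm (zonalHarm_mem hm y k), eval_zonalHarm]
  have := zonalLead_pos hm k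
  field_simp

instance harm_finite (m k : ℕ) : Module.Finite ℝ (harm m k) := by
  have : Module.Finite ℝ (homogeneousSubmodule (Fin m) ℝ k) :=
    Module.Finite.iff_fg.2 (homogeneousSubmodule_fg (Fin m) ℝ k)
  exact Submodule.finiteDimensional_inf_left _ _

theorem exists_harm_ne_zero (hm : 2 ≤ m) (k : ℕ) : ∃ p ∈ harm m k, p ≠ 0 := by
  -- With a unit pole, the zonal harmonic takes the value `1` at that pole.
  refine ⟨zonalHarm (Pi.single ⟨0, by omega⟩ 1) k, zonalHarm_mem hm _ k, fun h => ?_⟩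
  have := eval_zonalHarm (Pi.single (⟨0, by omega⟩ : Fin m) (1 : ℝ)) (Pi.single ⟨0, by omega⟩ 1) k
  rw [h] at this
  simp [Pi.single_apply, zonalForm_one_one hm] at this

theorem harmDim_pos (hm : 2 ≤ m) (k : ℕ) : 0 < harmDim m k := by
  obtain ⟨p, hp, h0⟩ := exists_harm_ne_zero hm k
  have : Nontrivial (harm m k) := ⟨⟨p, hp⟩, 0, fun h => h0 (congrArg Subtype.val h)⟩
  exact Module.finrank_pos

end Harmonic

/-! ### Independence of harmonic polynomials on the sphere -/

section Independence

variable {m : ℕ}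

theorem eval_smul_of_isHomogeneous {k : ℕ} {p : MvPolynomial (Fin m) ℝ} (hp : p.IsHomogeneous k)
    (c : ℝ) (y : Fin m → ℝ) : eval (c • y) p = c ^ k * eval y p := by
  rw [eval_eq, eval_eq, Finset.mul_sum]
  refine Finset.sum_congr rfl fun μ hμ => ?_
  have hd := hp (mem_support_iff.1 hμ)
  have hd : ∑ i ∈ μ.support, μ i = k := by
    rw [← hd, Finsupp.weight_apply]
    simp [Finsupp.sum]
  rw [← hd, ← Finset.prod_pow_eq_pow_sum]
  simp only [Pi.smul_apply, smul_eq_mul, mul_pow, Finset.prod_mul_distrib]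
  ring

theorem exists_smul_unit (hm : 2 ≤ m) (x : Fin m → ℝ) :
    ∃ (c : ℝ) (y : Fin m → ℝ), x = c • y ∧ ∑ i, y i ^ 2 = 1 := by
  by_cases hx : x = 0
  · exact ⟨0, Pi.single ⟨0, by omega⟩ 1, by simp [hx], by simp [Pi.single_apply]⟩
  · have h0 : 0 < ∑ i, x i ^ 2 := by
      obtain ⟨i, hi⟩ := Function.ne_iff.1 hx
      have hi : x i ≠ 0 := hi
      exact Finset.sum_pos' (fun _ _ => sq_nonneg _) ⟨i, Finset.mem_univ _, by positivity⟩
    refine ⟨√(∑ i, x i ^ 2), (√(∑ i, x i ^ 2))⁻¹ • x, ?_, ?_⟩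
    · rw [smul_smul, mul_inv_cancel₀ (Real.sqrt_pos.2 h0).ne', one_smul]
    · simp only [Pi.smul_apply, smul_eq_mul, mul_pow, ← Finset.mul_sum, inv_pow]
      rw [Real.sq_sqrt h0.le, inv_mul_cancel₀ h0.ne']

/-- Harmonic homogeneous polynomials of different degrees are independent on the sphere. -/
theorem harm_eq_zero_of_sum_eq_zero (hm : 2 ≤ m) (d : ℕ) (H : Fin d → MvPolynomial (Fin m) ℝ)
    (hH : ∀ k : Fin d, H k ∈ harm m k)
    (h : ∀ y : Fin m → ℝ, ∑ i, y i ^ 2 = 1 → ∑ k, eval y (H k) = 0) : ∀ k, H k = 0 := by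
  induction d with
  | zero => exact fun k => k.elim0
  | succ d ih =>
    -- Only degrees of the parity of `d` can be raised to `d` by powers of `normSq`. On the sphere
    -- `g` is half of the sum at `y` plus `(-1)^d` times the sum at `-y`, hence zero.
    set g : MvPolynomial (Fin m) ℝ := ∑ k : Fin (d + 1),
      if Even (d - k : ℕ) then normSq (Fin m) ^ ((d - k : ℕ) / 2) * H k else 0 with hg
    have hg0 : g = 0 := by
      refine MvPolynomial.funext fun x => ?_
      obtain ⟨c, y, rfl, hy⟩ := exists_smul_unit hm x
      have hterm : ∀ k : Fin (d + 1),
          eval (c • y) (if Even (d - k : ℕ) then normSq (Fin m) ^ ((d - k : ℕ) / 2) * H k else 0) =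
            c ^ d / 2 * (eval y (H k) + (-1) ^ d * eval ((-1 : ℝ) • y) (H k)) := by
        intro k
        have hk : (k : ℕ) ≤ d := Nat.lt_succ_iff.1 k.2
        rw [eval_smul_of_isHomogeneous (mem_harm.1 (hH k)).1]
        have hs : (-1 : ℝ) ^ d * (-1) ^ (k : ℕ) = (-1) ^ (d - k : ℕ) := by
          nth_rw 1 [← Nat.sub_add_cancel hk]
          rw [pow_add, mul_assoc, ← pow_add, ← two_mul, pow_mul]
          simp
        split_ifs with he
        · rw [map_mul, eval_smul_of_isHomogeneous (mem_harm.1 (hH k)).1, map_pow,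
            eval_smul_of_isHomogeneous normSq_isHomogeneous, ← mul_assoc ((-1 : ℝ) ^ d), hs,
            he.neg_one_pow]
          have h1 : eval y (normSq (Fin m)) = 1 := by simpa [normSq] using hy
          rw [h1, mul_one, ← pow_mul, Nat.mul_div_cancel' he.two_dvd, ← mul_assoc, ← pow_add,
            Nat.sub_add_cancel hk]
          ring
        · rw [← mul_assoc ((-1 : ℝ) ^ d), hs, (Nat.not_even_iff_odd.1 he).neg_one_pow, map_zero]
          ring
      rw [hg, map_sum, Finset.sum_congr rfl fun k _ => hterm k, ← Finset.mul_sum,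
        Finset.sum_add_distrib, ← Finset.mul_sum, h y hy, h ((-1 : ℝ) • y) (by simpa using hy)]
      simp
    have hlast : H (Fin.last d) = 0 := by
      by_contra hne
      have hpos := fischer_self_pos hne
      -- Every term of `g` of lower index is a multiple of `normSq`, thus orthogonal to the harmonic
      -- top term.
      have hz : fischer (H (Fin.last d)) g = fischer (H (Fin.last d)) (H (Fin.last d)) := by
        rw [hg, Fin.sum_univ_castSucc, map_add, map_sum, Finset.sum_eq_zero, zero_add]
        · simp
        · intro k _
          split_ifs with he
          · obtain ⟨i, hi⟩ := he
            have hk := k.2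
            simp only [Fin.val_castSucc] at hi ⊢
            rw [show (d - k : ℕ) / 2 = (i - 1) + 1 by omega, pow_succ', mul_assoc,
              ← fischer_laplacian, (mem_harm.1 (hH (Fin.last d))).2]
            simp
          · simp
      rw [hg0, map_zero] at hz
      exact hpos.ne hz
    have hrest := ih (fun k => H k.castSucc) (fun k => hH k.castSucc) fun y hy => by
      have := h y hy
      rw [Fin.sum_univ_castSucc, hlast, map_zero, add_zero] at this
      exact this
    exact fun k => Fin.lastCases hlast hrest k

/-- The zonal polynomials as a sequence of polynomials of degrees `0, 1, 2, …`. -/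
def zonalSequence {n : ℕ} (hn : 2 ≤ n) : Polynomial.Sequence ℝ where
  elems' := zonal n
  degree_eq' := zonal_degree hn

theorem eq_zero_of_sum_zonal_eq_zero {n : ℕ} (hn : 2 ≤ n) {N : ℕ} (a : Fin N → ℝ)
    (h : ∀ u ∈ Set.Ioo (-1 : ℝ) 1, ∑ i : Fin N, (zonal n i).eval u * a i = 0) : ∀ i, a i = 0 := by
  have hli : LinearIndependent ℝ fun i : Fin N => zonal n i :=
    (zonalSequence hn).linearIndependent.comp _ Fin.val_injective
  refine Fintype.linearIndependent_iff.1 hli a ?_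
  refine Polynomial.eq_zero_of_infinite_isRoot _ 
    ((Set.Ioo_infinite (show (-1 : ℝ) < 1 by norm_num)).mono fun u hu => ?_)
  rw [Set.mem_ofPred_eq, Polynomial.IsRoot, Polynomial.eval_finsetSum, ← h u hu]
  exact Finset.sum_congr rfl fun i _ => by rw [Polynomial.eval_smul, smul_eq_mul, mul_comm]

/-- For fixed `u`, varying `y` separates the degrees `k`; the factor `√(1 - u²)^k` is nonzero
because `|u| < 1`. Varying `u` then separates the `i`, coefficient by coefficient. -/
theorem harm_family_eq_zero (hm : 2 ≤ m) {n : ℕ} (hn : 2 ≤ n) {d : ℕ} {N : Fin d → ℕ}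
    (G : (k : Fin d) → Fin (N k) → MvPolynomial (Fin m) ℝ) (hG : ∀ (k : Fin d) (i : Fin (N k)), G k i ∈ harm m k)
    (h : ∀ u ∈ Set.Ioo (-1 : ℝ) 1, ∀ y : Fin m → ℝ, ∑ i, y i ^ 2 = 1 →
      ∑ k : Fin d, ∑ i : Fin (N k), (zonal (n + 2 * k) i).eval u * eval (√(1 - u ^ 2) • y) (G k i) = 0) :
    ∀ k i, G k i = 0 := by
  have key : ∀ u ∈ Set.Ioo (-1 : ℝ) 1, ∀ k : Fin d,
      ∑ i : Fin (N k), (zonal (n + 2 * k) i).eval u • G k i = 0 := by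
    intro u hu k
    have hs : √(1 - u ^ 2) ≠ 0 := (Real.sqrt_pos.2 (by nlinarith [hu.1, hu.2])).ne'
    have := harm_eq_zero_of_sum_eq_zero hm d
      (fun k => √(1 - u ^ 2) ^ (k : ℕ) • ∑ i : Fin (N k), (zonal (n + 2 * k) i).eval u • G k i)
      (fun k => Submodule.smul_mem _ _ (Submodule.sum_mem _ fun i _ =>
        Submodule.smul_mem _ _ (hG k i))) (fun y hy => by
        rw [← h u hu y hy]
        refine Finset.sum_congr rfl fun k _ => ?_
        simp only [smul_eval, map_sum, Finset.mul_sum,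
          eval_smul_of_isHomogeneous (mem_harm.1 (hG k _)).1]
        exact Finset.sum_congr rfl fun i _ => by ring) k
    exact (smul_eq_zero.1 this).resolve_left (pow_ne_zero _ hs)
  intro k i
  ext μ
  refine eq_zero_of_sum_zonal_eq_zero (n := n + 2 * k) (by omega) (fun i => coeff μ (G k i))
    (fun u hu => ?_) i
  have := congrArg (coeff μ) (key u hu k)
  simpa [coeff_sum] using this

/-- Definiteness makes the map into the dual injective, and dimensions agree. -/
theorem exists_harm_representative {k : ℕ} (f : harm m k →ₗ[ℝ] ℝ) :
    ∃ G : harm m k, ∀ p : harm m k, f p = fischer (p : MvPolynomial (Fin m) ℝ) G := by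
  let B : harm m k →ₗ[ℝ] Module.Dual ℝ (harm m k) := fischer.domRestrict₁₂ (harm m k) (harm m k)
  have hB : Function.Injective B := by
    rw [← LinearMap.ker_eq_bot, LinearMap.ker_eq_bot']
    intro p hp
    by_contra h0
    have : fischer (p : MvPolynomial (Fin m) ℝ) p = 0 := LinearMap.congr_fun hp p
    exact (fischer_self_pos fun h => h0 (Subtype.ext h)).ne' this
  obtain ⟨G, hG⟩ := (LinearMap.injective_iff_surjective_of_finrank_eq_finrank
    Subspace.dual_finrank_eq.symm).1 hB f
  exact ⟨G, fun p => by rw [← hG, fischer_comm]; rfl⟩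

/-- The vectors of values of the functions `P_i^{n+2k}(u) Z_k(x)`, where `Z_k(x)` is the zonal
harmonic with pole `x`. -/
def zonalVector (hm : 2 ≤ m) (n : ℕ) {d : ℕ} (N : Fin d → ℕ) (u : ℝ) (x : Fin m → ℝ) :
    (k : Fin d) → Fin (N k) → harm m k :=
  fun k i => (zonal (n + 2 * k) i).eval u • ⟨zonalHarm x k, zonalHarm_mem hm x k⟩

/-- By duality: the components of a functional killing all these vectors are represented by harmonic
polynomials, and the reproducing property turns its vanishing into the relation of
`harm_family_eq_zero`. -/
theorem span_zonalVector (hm : 2 ≤ m) {n : ℕ} (hn : 2 ≤ n) {d : ℕ} (N : Fin d → ℕ) {X : Type*}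
    (u : X → ℝ) (x : X → Fin m → ℝ)
    (hX : ∀ a ∈ Set.Ioo (-1 : ℝ) 1, ∀ y : Fin m → ℝ, ∑ i, y i ^ 2 = 1 →
      ∃ c, u c = a ∧ x c = √(1 - a ^ 2) • y) :
    Submodule.span ℝ (Set.range fun c => zonalVector hm n N (u c) (x c)) = ⊤ := by
  classical
  by_contra hne
  obtain ⟨f, hf, hle⟩ := Submodule.exists_le_ker_of_lt_top _ (lt_top_iff_ne_top.2 hne)
  apply hf
  let g (k : Fin d) (i : Fin (N k)) : harm m k →ₗ[ℝ] ℝ :=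
    f ∘ₗ LinearMap.single ℝ (fun k : Fin d => Fin (N k) → harm m k) k ∘ₗ
      LinearMap.single ℝ (fun _ : Fin (N k) => harm m k) i
  have hfg : ∀ w, f w = ∑ k, ∑ i, g k i (w k i) := by
    intro w
    conv_lhs => rw [← Finset.univ_sum_single w, map_sum]
    refine Finset.sum_congr rfl fun k _ => ?_
    conv_lhs => rw [← Finset.univ_sum_single (w k)]
    have : f (Pi.single k (∑ i, Pi.single i (w k i))) =
      (f ∘ₗ LinearMap.single ℝ (fun k : Fin d => Fin (N k) → harm m k) k)
        (∑ i, Pi.single i (w k i)) := rfl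
    rw [this, map_sum]
    rfl
  choose G hG using fun k i => exists_harm_representative (g k i)
  have hG0 := harm_family_eq_zero hm hn
    (fun (k : Fin d) i => (zonalLead m k * (k : ℕ).factorial) • (G k i : MvPolynomial (Fin m) ℝ))
    (fun k i => Submodule.smul_mem _ _ (G k i).2) (fun a ha y hy => by
      obtain ⟨c, hc1, hc2⟩ := hX a ha y hy
      have h0 : f (zonalVector hm n N (u c) (x c)) = 0 :=
        LinearMap.mem_ker.1 (hle (Submodule.subset_span ⟨c, rfl⟩))
      rw [hfg] at h0
      rw [← h0, ← hc2, ← hc1]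
      refine Finset.sum_congr rfl fun k _ => Finset.sum_congr rfl fun i _ => ?_
      rw [zonalVector, LinearMap.map_smul, hG, fischer_comm, fischer_zonalHarm (G k i).2, smul_eval,
        smul_eq_mul])
  refine LinearMap.ext fun w => ?_
  rw [hfg, LinearMap.zero_apply]
  refine Finset.sum_eq_zero fun k _ => Finset.sum_eq_zero fun i _ => ?_
  have h1 := (smul_eq_zero.1 (hG0 k i)).resolve_left
    (mul_pos (zonalLead_pos hm k) (by positivity)).ne'
  rw [hG, h1, map_zero]

end Independence

/-! ### Expansions in the zonal matrices -/

section Expansion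

/-- The span of the polynomials `U^i V^j Q_k` with `i + k ≤ M` and `j + k ≤ N`. -/
def zonalSpan (m M N : ℕ) : Submodule ℝ Poly3 :=
  Submodule.span ℝ {p | ∃ i j k, i + k ≤ M ∧ j + k ≤ N ∧ p = U ^ i * V ^ j * Q m k}

theorem mem_zonalSpan {m M N i j k : ℕ} (hi : i + k ≤ M) (hj : j + k ≤ N) :
    U ^ i * V ^ j * Q m k ∈ zonalSpan m M N :=
  Submodule.subset_span ⟨i, j, k, hi, hj, rfl⟩

theorem zonalSpan_mono {m M N M' N' : ℕ} (hM : M ≤ M') (hN : N ≤ N') :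
    zonalSpan m M N ≤ zonalSpan m M' N' :=
  Submodule.span_mono fun _ ⟨i, j, k, hi, hj, h⟩ => ⟨i, j, k, hi.trans hM, hj.trans hN, h⟩

theorem mul_mem_of_generators {S S' : Submodule ℝ Poly3} {s : Set Poly3} (hS : S = .span ℝ s)
    {f p : Poly3} (hp : p ∈ S) (h : ∀ q ∈ s, f * q ∈ S') : f * p ∈ S' := by
  subst hS
  have : Submodule.span ℝ s ≤ S'.comap (LinearMap.mulLeft ℝ f) := Submodule.span_le.2 h
  exact this hp

theorem U_mul_mem {m M N : ℕ} {p : Poly3} (hp : p ∈ zonalSpan m M N) :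
    U * p ∈ zonalSpan m (M + 1) N := by
  refine mul_mem_of_generators rfl hp ?_
  rintro _ ⟨i, j, k, hi, hj, rfl⟩
  convert mem_zonalSpan (m := m) (M := M + 1) (i := i + 1) (j := j) (k := k) (by omega) hj
    using 1
  ring

theorem V_mul_mem {m M N : ℕ} {p : Poly3} (hp : p ∈ zonalSpan m M N) :
    V * p ∈ zonalSpan m M (N + 1) := by
  refine mul_mem_of_generators rfl hp ?_
  rintro _ ⟨i, j, k, hi, hj, rfl⟩
  convert mem_zonalSpan (m := m) (N := N + 1) (i := i) (j := j + 1) (k := k) hi (by omega)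
    using 1
  ring

/-- Write `T = UV + (T - UV)`. The recurrence expresses `(T - UV) Q_{k+1}` through `Q_{k+2}` and `(1
- U²)(1 - V²) Q_k`, which raises each of the two degree bounds by only one. -/
theorem T_mul_mem {m : ℕ} (hm : 2 ≤ m) {M N : ℕ} {p : Poly3} (hp : p ∈ zonalSpan m M N) :
    T * p ∈ zonalSpan m (M + 1) (N + 1) := by
  refine mul_mem_of_generators rfl hp ?_
  rintro _ ⟨i, j, k, hi, hj, rfl⟩
  have hUV : U ^ (i + 1) * V ^ (j + 1) * Q m k ∈ zonalSpan m (M + 1) (N + 1) :=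
    mem_zonalSpan (by omega) (by omega)
  suffices h : U ^ i * V ^ j * ((T - U * V) * Q m k) ∈ zonalSpan m (M + 1) (N + 1) by
    convert add_mem h hUV using 1
    ring
  cases k with
  | zero =>
    convert mem_zonalSpan (m := m) (M := M + 1) (N := N + 1) (i := i) (j := j) (k := 1)
      (by omega) (by omega) using 2
    rw [Q_eq_zonalForm hm, Q_eq_zonalForm hm]
    simp [zonalForm]
  | succ k =>
    have hpos := natCast_add_sub_one_pos hm k
    have h2 : (0 : ℝ) < (2 * k + m) / (k + m - 1) := by
      have : (0 : ℝ) < m := by positivity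
      positivity
    have hrec : (T - U * V) * Q m (k + 1) = ((2 * k + m) / (k + m - 1) : ℝ)⁻¹ • (Q m (k + 2) +
        ((k + 1) / (k + m - 1) : ℝ) • ((1 - U ^ 2) * (1 - V ^ 2) * Q m k)) := by
      simp only [Q_eq_zonalForm hm]
      rw [zonalForm_add_two, sub_add_cancel, inv_smul_smul₀ h2.ne']
    rw [hrec, mul_smul_comm, mul_add, mul_smul_comm]
    refine Submodule.smul_mem _ _ (add_mem (mem_zonalSpan (by omega) (by omega))
      (Submodule.smul_mem _ _ ?_))
    have e : U ^ i * V ^ j * ((1 - U ^ 2) * (1 - V ^ 2) * Q m k) =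
        U ^ i * V ^ j * Q m k - U ^ (i + 2) * V ^ j * Q m k - U ^ i * V ^ (j + 2) * Q m k +
          U ^ (i + 2) * V ^ (j + 2) * Q m k := by ring
    rw [e]
    exact add_mem (sub_mem (sub_mem (mem_zonalSpan (by omega) (by omega))
      (mem_zonalSpan (by omega) (by omega))) (mem_zonalSpan (by omega) (by omega)))
      (mem_zonalSpan (by omega) (by omega))

theorem monomial_mem_zonalSpan {m : ℕ} (hm : 2 ≤ m) (a b c : ℕ) :
    U ^ a * (V ^ b * T ^ c) ∈ zonalSpan m (a + c) (b + c) := by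
  induction a with
  | zero =>
    rw [pow_zero, one_mul, zero_add]
    induction b with
    | zero =>
      rw [pow_zero, one_mul, zero_add]
      induction c with
      | zero =>
        have := mem_zonalSpan (m := m) (i := 0) (j := 0) (k := 0) (M := 0) (N := 0) le_rfl le_rfl
        rw [Q_eq_zonalForm hm] at this
        simpa [zonalForm] using this
      | succ c ih => rw [pow_succ']; exact T_mul_mem hm ih
    | succ b ih =>
      rw [pow_succ', mul_assoc]
      exact zonalSpan_mono le_rfl (by omega) (V_mul_mem ih)
  | succ a ih =>
    rw [pow_succ', mul_assoc]
    exact zonalSpan_mono (by omega) le_rfl (U_mul_mem ih)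

theorem mem_zonalSpan_of_mem_R {m : ℕ} (hm : 2 ≤ m) {d : ℕ} {F : Poly3} (hF : F ∈ R d) :
    F ∈ zonalSpan m d d := by
  obtain ⟨hsym, hdeg, -⟩ := hF
  have hw : ∀ μ ∈ F.support, μ 0 + μ 2 ≤ d := by
    intro μ hμ
    have := (le_weightedTotalDegree (![1, 0, 1] : Fin 3 → ℕ) hμ).trans hdeg
    rw [Finsupp.weight_apply, Finsupp.sum_fintype _ _ (by simp)] at this
    simpa [Fin.sum_univ_three] using this
  rw [F.as_sum]
  refine Submodule.sum_mem _ fun μ hμ => ?_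
  have h1 := hw μ hμ
  -- Symmetry of `F` transfers the bound on the degree in `(u, t)` to `(v, t)`.
  have h2 : μ 1 + μ 2 ≤ d := by
    have hν : μ.mapDomain (Equiv.swap (0 : Fin 3) 1) ∈ F.support := by
      rw [mem_support_iff] at hμ ⊢
      rwa [← hsym, swapUV, coeff_rename_mapDomain _ (Equiv.injective _)]
    have := hw _ hν
    rwa [← Finsupp.equivMapDomain_eq_mapDomain, Finsupp.equivMapDomain_apply,
      Finsupp.equivMapDomain_apply, Equiv.symm_swap, Equiv.swap_apply_left,
      Equiv.swap_apply_of_ne_of_ne (by decide) (by decide)] at this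
  have e : monomial μ (coeff μ F) = coeff μ F • (U ^ μ 0 * (V ^ μ 1 * T ^ μ 2)) := by
    rw [monomial_eq, Finsupp.prod_fintype _ _ (by simp), Fin.prod_univ_three, smul_eq_C_mul,
      U, V, T, mul_assoc (X 0 ^ _)]
  rw [e]
  exact Submodule.smul_mem _ _ (zonalSpan_mono h1 h2 (monomial_mem_zonalSpan hm _ _ _))

/-! ### Positivity of the constants and expansion with symmetric coefficients -/

theorem sphereArea_pos {n : ℕ} (hn : 1 ≤ n) : 0 < sphereArea n := by
  have : Nonempty (Fin n) := ⟨⟨0, hn⟩⟩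
  rw [sphereArea, MeasureTheory.Measure.toSphere_real_apply_univ]
  have h : 0 < MeasureTheory.volume.real (Metric.ball (0 : EuclideanSpace ℝ (Fin n)) 1) :=
    ENNReal.toReal_pos (Metric.measure_ball_pos _ _ one_pos).ne' MeasureTheory.measure_ball_lt_top.ne
  have h' : 0 < Module.finrank ℝ (EuclideanSpace ℝ (Fin n)) := by simp; omega
  positivity

/-- The scalar factor of `λ_{i,j}` that depends on `n` and `k` only. -/
def areaRatio (n k : ℕ) : ℝ :=
  sphereArea n / sphereArea (n - 1) * (sphereArea (n + 2 * k - 1) / sphereArea (n + 2 * k))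

theorem areaRatio_pos {n : ℕ} (hn : 2 ≤ n) (k : ℕ) : 0 < areaRatio n k := by
  have h1 := sphereArea_pos (n := n) (by omega)
  have h2 := sphereArea_pos (n := n - 1) (by omega)
  have h3 := sphereArea_pos (n := n + 2 * k - 1) (by omega)
  have h4 := sphereArea_pos (n := n + 2 * k) (by omega)
  unfold areaRatio
  positivity

theorem lam_eq (n k i j : ℕ) : lam n k i j =
    areaRatio n k * (√(harmDim (n + 2 * k) i) * √(harmDim (n + 2 * k) j)) := by
  rw [lam, areaRatio, Real.sqrt_mul (Nat.cast_nonneg _)]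

theorem sqrt_harmDim_pos {n : ℕ} (hn : 2 ≤ n) (k : ℕ) : 0 < √(harmDim n k : ℝ) :=
  Real.sqrt_pos.2 (by exact_mod_cast harmDim_pos hn k)

theorem lam_pos {n : ℕ} (hn : 2 ≤ n) (k i j : ℕ) : 0 < lam n k i j := by
  rw [lam_eq]
  have h1 := areaRatio_pos hn k
  have h2 := sqrt_harmDim_pos (n := n + 2 * k) (by omega) i
  have h3 := sqrt_harmDim_pos (n := n + 2 * k) (by omega) j
  positivity

/-- The families of matrices that serve as coefficients of expansions. -/
abbrev Coeffs (d : ℕ) : Type := (k : Fin (d + 1)) → Matrix (Fin (d - k + 1)) (Fin (d - k + 1)) ℝ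

/-- The polynomial `∑_k ⟨A_k, Y_k⟩` as a linear function of the matrices `A_k`. -/
def rawExpansion (n d : ℕ) : Coeffs d →ₗ[ℝ] Poly3 where
  toFun A := ∑ k, ∑ i, ∑ j, A k i j • Y n d k i j
  map_add' A B := by simp only [Pi.add_apply, Matrix.add_apply, add_smul, Finset.sum_add_distrib]
  map_smul' c A := by
    simp only [Pi.smul_apply, Matrix.smul_apply, smul_assoc, Finset.smul_sum, RingHom.id_apply]

theorem rawExpansion_apply (n d : ℕ) (A : Coeffs d) :
    rawExpansion n d A = ∑ k, ∑ i, ∑ j, A k i j • Y n d k i j := rfl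

theorem Y_mem_range (n d : ℕ) (k : Fin (d + 1)) (i j : Fin (d - k + 1)) :
    Y n d k i j ∈ LinearMap.range (rawExpansion n d) := by
  classical
  refine ⟨Pi.single k (Matrix.single i j 1), ?_⟩
  rw [rawExpansion_apply, Finset.sum_eq_single k, Finset.sum_eq_single i, Finset.sum_eq_single j]
  · simp
  · intro j' _ hj; simp [Matrix.single, hj.symm]
  · simp
  · intro i' _ hi; simp [Matrix.single, hi.symm]
  · simp
  · intro k' _ hk; simp [Pi.single_eq_of_ne hk]
  · simp

theorem span_zonal {n : ℕ} (hn : 2 ≤ n) (N : ℕ) :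
    Submodule.span ℝ (zonal n '' Set.Iic N) = Polynomial.degreeLE ℝ N :=
  (zonalSequence hn).span_degreeLE fun i _ =>
    isUnit_iff_ne_zero.2 (Polynomial.leadingCoeff_ne_zero.2 ((zonalSequence hn).ne_zero i))

/-- The `P_i` with `i ≤ d - k` span all polynomials of degree at most `d - k`, so powers of `V`, and
then of `U`, can replace zonal polynomials. -/
theorem generator_mem_range {n : ℕ} (hn : 2 ≤ n) {d i j k : ℕ} (hi : i + k ≤ d) (hj : j + k ≤ d) :
    U ^ i * V ^ j * Q (n - 1) k ∈ LinearMap.range (rawExpansion n d) := by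
  set W := LinearMap.range (rawExpansion n d)
  have h1 : ∀ i' ∈ Set.Iic (d - k), ∀ j' ∈ Set.Iic (d - k),
      Polynomial.aeval U (zonal (n + 2 * k) i') *
        (Polynomial.aeval V (zonal (n + 2 * k) j') * Q (n - 1) k) ∈ W := by
    intro i' hi' j' hj'
    rw [Set.mem_Iic] at hi' hj'
    have hY := Submodule.smul_mem W (lam n k i' j')⁻¹
      (Y_mem_range n d ⟨k, by omega⟩ ⟨i', by simp; omega⟩ ⟨j', by simp; omega⟩)
    convert hY using 1
    simp only [Y, Matrix.of_apply]
    rw [← C_mul', ← mul_assoc (C _), ← mul_assoc (C _), ← mul_assoc (C _), ← C_mul,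
      inv_mul_cancel₀ (lam_pos hn k i' j').ne', C_1, one_mul, mul_assoc]
  have hX : ∀ {i}, i ≤ d - k →
      (Polynomial.X ^ i : Polynomial ℝ) ∈ Submodule.span ℝ (zonal (n + 2 * k) '' Set.Iic (d - k)) := by
    intro i hi
    rw [span_zonal (by omega), Polynomial.mem_degreeLE]
    exact (Polynomial.degree_X_pow_le i).trans (by exact_mod_cast hi)
  have h2 : ∀ i' ∈ Set.Iic (d - k),
      Polynomial.aeval U (zonal (n + 2 * k) i') * (V ^ j * Q (n - 1) k) ∈ W := by
    intro i' hi'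
    have hle : Submodule.span ℝ (zonal (n + 2 * k) '' Set.Iic (d - k)) ≤
        W.comap (LinearMap.mulLeft ℝ (Polynomial.aeval U (zonal (n + 2 * k) i')) ∘ₗ
          LinearMap.mulRight ℝ (Q (n - 1) k) ∘ₗ (Polynomial.aeval V).toLinearMap) := by
      rw [Submodule.span_le]
      rintro _ ⟨j', hj', rfl⟩
      exact h1 i' hi' j' hj'
    simpa using hle (hX (i := j) (by omega))
  have hle : Submodule.span ℝ (zonal (n + 2 * k) '' Set.Iic (d - k)) ≤
      W.comap (LinearMap.mulRight ℝ (V ^ j * Q (n - 1) k) ∘ₗ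
        (Polynomial.aeval U).toLinearMap) := by
    rw [Submodule.span_le]
    rintro _ ⟨i', hi', rfl⟩
    exact h2 i' hi'
  simpa [mul_assoc] using hle (hX (i := i) (by omega))

theorem swapUV_Q {m : ℕ} (hm : 2 ≤ m) (k : ℕ) : swapUV (Q m k) = Q m k := by
  rw [Q_eq_zonalForm hm, swapUV, map_zonalForm]
  congr 1
  · simp [U, V, T, Equiv.swap_apply_of_ne_of_ne, mul_comm]
  · simp [U, V, mul_comm]

theorem swapUV_Y {n : ℕ} (hn : 3 ≤ n) (d k : ℕ) (i j : Fin (d - k + 1)) :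
    swapUV (Y n d k i j) = Y n d k j i := by
  have hU : rename (Equiv.swap (0 : Fin 3) 1) U = V := by simp [U, V]
  have hV : rename (Equiv.swap (0 : Fin 3) 1) V = U := by simp [U, V]
  have hQ := swapUV_Q (m := n - 1) (by omega) k
  simp only [swapUV, Y, Matrix.of_apply, map_mul, rename_C, ← Polynomial.aeval_algHom_apply] at hQ ⊢
  rw [hU, hV, hQ, lam_eq, lam_eq, mul_comm (√_) (√_)]
  ring

theorem swapUV_rawExpansion {n : ℕ} (hn : 3 ≤ n) (d : ℕ) (A : Coeffs d) :
    swapUV (rawExpansion n d A) = rawExpansion n d fun k => (A k).transpose := by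
  have h : ∀ (k : Fin (d + 1)) i j, rename (Equiv.swap (0 : Fin 3) 1) (Y n d k i j) =
    Y n d k j i := fun k i j => swapUV_Y hn d k i j
  simp only [swapUV, rawExpansion_apply, map_sum, map_smul, h, Matrix.transpose_apply]
  exact Finset.sum_congr rfl fun k _ => Finset.sum_comm

/-- Exchanging `u` and `v` transposes the coefficient matrices, so symmetric ones do not see the
symmetrization of `Y`. -/
theorem expansion_eq_rawExpansion {n : ℕ} (hn : 3 ≤ n) (d : ℕ) (A : Coeffs d)
    (hA : ∀ k, (A k).IsSymm) : expansion n d A = rawExpansion n d A := by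
  have h1 : expansion n d A =
      (1 / 2 : ℝ) • (rawExpansion n d A + swapUV (rawExpansion n d A)) := by
    rw [swapUV, rawExpansion_apply]
    simp only [expansion, pairing, Matrix.trace, Matrix.diag, Matrix.mul_apply, Matrix.map_apply,
      Matrix.transpose_apply, Ybar, Matrix.of_apply, map_sum, map_smul, ← Finset.sum_add_distrib,
      Finset.smul_sum, swapUV]
    refine Finset.sum_congr rfl fun k _ => Finset.sum_congr rfl fun i _ =>
      Finset.sum_congr rfl fun j _ => ?_
    simp only [smul_eq_C_mul]
    ring
  have h2 : (fun k => (A k).transpose) = A := funext hA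
  rw [h1, swapUV_rawExpansion hn, h2, ← two_smul ℝ, smul_smul]
  norm_num

/-- Every polynomial in `R_d` has an expansion with symmetric matrix coefficients. -/
theorem exists_expansion {n : ℕ} (hn : 3 ≤ n) {d : ℕ} {F : Poly3} (hF : F ∈ R d) :
    ∃ A : Coeffs d, (∀ k, (A k).IsSymm) ∧ F = expansion n d A := by
  have hle : zonalSpan (n - 1) d d ≤ LinearMap.range (rawExpansion n d) := by
    refine Submodule.span_le.2 ?_
    rintro _ ⟨i, j, k, hi, hj, rfl⟩
    exact generator_mem_range (by omega) hi hj
  obtain ⟨A, rfl⟩ := hle (mem_zonalSpan_of_mem_R (by omega) hF)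
  -- Averaging the coefficients with their transposes averages `F` with `swapUV F`, which is `F`
  -- again.
  have hsymm : ∀ k, ((1 / 2 : ℝ) • (A k + (A k).transpose)).IsSymm := fun k => by
    rw [Matrix.IsSymm, Matrix.transpose_smul, Matrix.transpose_add, Matrix.transpose_transpose,
      add_comm (A k).transpose]
  refine ⟨_, hsymm, ?_⟩
  rw [expansion_eq_rawExpansion hn d _ hsymm]
  have hB : (fun k => (1 / 2 : ℝ) • (A k + (A k).transpose)) =
    (1 / 2 : ℝ) • (A + fun k => (A k).transpose) := rfl
  rw [hB, map_smul, map_add, ← swapUV_rawExpansion hn, hF.1, ← two_smul ℝ, smul_smul]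
  norm_num

end Expansion

/-! ### Positive definite kernels on the sphere -/

section Kernel

/-- Coordinates on the sphere of `ℝ^{m+1}` adapted to the point `e`: the component along `e` and
the remaining `m` coordinates. -/
theorem exists_sphere_coordinates {m : ℕ}
    (e : Metric.sphere (0 : EuclideanSpace ℝ (Fin (m + 1))) 1) :
    ∃ x : Metric.sphere (0 : EuclideanSpace ℝ (Fin (m + 1))) 1 → Fin m → ℝ,
      (∀ c c', inner ℝ c.1 c'.1 = inner ℝ e.1 c.1 * inner ℝ e.1 c'.1 + ∑ i, x c i * x c' i) ∧
      ∀ a ∈ Set.Ioo (-1 : ℝ) 1, ∀ y : Fin m → ℝ, ∑ i, y i ^ 2 = 1 →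
        ∃ c, inner ℝ e.1 c.1 = a ∧ x c = √(1 - a ^ 2) • y := by
  have he : ‖e.1‖ = 1 := by simp
  have hv : Orthonormal ℝ (({0} : Set (Fin (m + 1))).domRestrict fun _ => e.1) := by
    refine ⟨fun _ => he, fun i j hij => (hij (Subsingleton.elim i j)).elim⟩
  obtain ⟨b, hb⟩ := hv.exists_orthonormalBasis_extension_of_card_eq (by simp)
  have hb0 : b 0 = e.1 := hb 0 rfl
  refine ⟨fun c i => inner ℝ (b i.succ) c.1, fun c c' => ?_, fun a ha y hy => ?_⟩
  · rw [← b.sum_inner_mul_inner, Fin.sum_univ_succ, hb0]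
    simp only [real_inner_comm c.1]
  · set z : EuclideanSpace ℝ (Fin (m + 1)) :=
      WithLp.toLp 2 (Fin.cons a (√(1 - a ^ 2) • y) : Fin (m + 1) → ℝ) with hz
    have hnz : ‖z‖ = 1 := by
      have h1 : √(1 - a ^ 2) ^ 2 = 1 - a ^ 2 := Real.sq_sqrt (by nlinarith [ha.1, ha.2])
      rw [EuclideanSpace.norm_eq, Real.sqrt_eq_one, Fin.sum_univ_succ]
      simp [hz, mul_pow, ← Finset.mul_sum, hy, h1]
    have hin : ∀ i, inner ℝ (b i) (b.repr.symm z) = z i := fun i => by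
      rw [← b.repr_apply_apply, LinearIsometryEquiv.apply_symm_apply]
    refine ⟨⟨b.repr.symm z, by simp [hnz]⟩, ?_, ?_⟩
    · rw [← hb0]; exact hin 0
    · funext i; exact hin i.succ

-- A factorization `A = Bᵗ B` turns the sum into a sum of Fischer square norms.
open scoped MatrixOrder in
theorem sum_mul_fischer_nonneg {σ ι : Type*} [Fintype σ] [Fintype ι]
    {A : Matrix ι ι ℝ} (hA : A.PosSemidef) (p : ι → MvPolynomial σ ℝ) :
    0 ≤ ∑ i, ∑ j, A i j * fischer (p i) (p j) := by
  classical
  obtain ⟨B, rfl⟩ := CStarAlgebra.nonneg_iff_eq_star_mul_self.1 hA.nonneg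
  have h : ∑ i, ∑ j, (star B * B) i j * fischer (p i) (p j) =
      ∑ r, fischer (∑ i, B r i • p i) (∑ i, B r i • p i) := by
    simp only [map_sum, map_smul, LinearMap.sum_apply, LinearMap.smul_apply, Matrix.mul_apply,
      Matrix.star_apply, star_trivial, Finset.sum_mul, Finset.mul_sum, smul_eq_mul]
    rw [Finset.sum_comm]
    conv_rhs => rw [Finset.sum_comm]; enter [2, j]; rw [Finset.sum_comm]
    refine Finset.sum_congr rfl fun i _ => Finset.sum_congr rfl fun j _ =>
      Finset.sum_congr rfl fun r _ => ?_
    ring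
  rw [h]
  exact Finset.sum_nonneg fun r _ => fischer_self_nonneg _

variable {m : ℕ}

/-- The sphere equations replace `1 - u²` and `1 - v²` by `|x|²` and `|y|²`, which puts `Q` in the
form of the Gram kernel. -/
theorem eval_Y (hm : 2 ≤ m) (d k : ℕ) (i j : Fin (d - k + 1)) (u v : ℝ) (x y : Fin m → ℝ)
    (hu : u ^ 2 + ∑ i, x i ^ 2 = 1) (hv : v ^ 2 + ∑ i, y i ^ 2 = 1) :
    eval ![u, v, u * v + ∑ i, x i * y i] (Y (m + 1) d k i j) =
      lam (m + 1) k i j * (zonalLead m k * k.factorial)⁻¹ *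
        fischer ((zonal (m + 1 + 2 * k) i).eval u • zonalHarm x k)
          ((zonal (m + 1 + 2 * k) j).eval v • zonalHarm y k) := by
  have hQ : eval ![u, v, u * v + ∑ i, x i * y i] (Q m k) =
      zonalForm m (∑ i, x i * y i) ((∑ i, x i ^ 2) * ∑ i, y i ^ 2) k := by
    rw [Q_eq_zonalForm hm, ← coe_aeval_eq_eval]
    refine (map_zonalForm (aeval ![u, v, u * v + ∑ i, x i * y i] : Poly3 →ₐ[ℝ] ℝ) m _ _ k).trans ?_
    congr 1
    · simp [U, V, T]
    · simp only [U, V, map_mul, map_sub, map_one, map_pow, aeval_X, Matrix.cons_val_zero,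
        Matrix.cons_val_one]
      rw [← eq_sub_of_add_eq' hu, ← eq_sub_of_add_eq' hv]
  have hP : ∀ (w : Poly3) (p : Polynomial ℝ) (a : Fin 3 → ℝ),
      eval a (Polynomial.aeval w p) = p.eval (eval a w) := fun w p a => by
    rw [← coe_aeval_eq_eval]
    exact (Polynomial.aeval_algHom_apply (aeval a : Poly3 →ₐ[ℝ] ℝ) w p).symm.trans
      (by rw [Polynomial.coe_aeval_eq_eval]; rfl)
  simp only [Y, Matrix.of_apply, map_mul, eval_C, hP, Nat.add_sub_cancel, hQ, map_smul,
    LinearMap.smul_apply, smul_eq_mul]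
  rw [zonalForm_eq_fischer hm]
  simp [U, V]
  ring

/-- Since `λ_{i,j}` factors, its square roots and the weights `α` can be absorbed into the vectors
by bilinearity. Both directions of the theorem read off this identity. -/
theorem sum_eval_rawExpansion (hm : 2 ≤ m) {X : Type*} (u : X → ℝ) (x : X → Fin m → ℝ)
    (hux : ∀ c, u c ^ 2 + ∑ i, x c i ^ 2 = 1) (d : ℕ) (A : Coeffs d) (S : Finset X) (α : X → ℝ) :
    ∑ c ∈ S, ∑ c' ∈ S, α c * α c' *
        eval ![u c, u c', u c * u c' + ∑ i, x c i * x c' i] (rawExpansion (m + 1) d A) =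
      ∑ k : Fin (d + 1), areaRatio (m + 1) k * (zonalLead m k * (k : ℕ).factorial)⁻¹ *
        ∑ i, ∑ j, A k i j * fischer
          (√(harmDim (m + 1 + 2 * k) i) • ∑ c ∈ S, α c •
            (zonalVector hm (m + 1) (fun k : Fin (d + 1) => d - k + 1) (u c) (x c) k i :
              MvPolynomial (Fin m) ℝ))
          (√(harmDim (m + 1 + 2 * k) j) • ∑ c ∈ S, α c •
            (zonalVector hm (m + 1) (fun k : Fin (d + 1) => d - k + 1) (u c) (x c) k j :
              MvPolynomial (Fin m) ℝ)) := by
  have h : ∀ c c', α c * α c' *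
      eval ![u c, u c', u c * u c' + ∑ i, x c i * x c' i] (rawExpansion (m + 1) d A) =
      ∑ k : Fin (d + 1), ∑ i, ∑ j, areaRatio (m + 1) k * (zonalLead m k * (k : ℕ).factorial)⁻¹ *
        A k i j * √(harmDim (m + 1 + 2 * k) i) * √(harmDim (m + 1 + 2 * k) j) * (α c * α c' *
        fischer (zonalVector hm (m + 1) (fun k : Fin (d + 1) => d - k + 1) (u c) (x c) k i :
              MvPolynomial (Fin m) ℝ)
            (zonalVector hm (m + 1) (fun k : Fin (d + 1) => d - k + 1) (u c') (x c') k j :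
              MvPolynomial (Fin m) ℝ)) := fun c c' => by
    simp only [rawExpansion_apply, map_sum, Finset.mul_sum, smul_eval]
    refine Finset.sum_congr rfl fun k _ => Finset.sum_congr rfl fun i _ =>
      Finset.sum_congr rfl fun j _ => ?_
    rw [eval_Y hm _ _ _ _ _ _ _ _ (hux c) (hux c'), lam_eq]
    simp only [zonalVector, Submodule.coe_smul]
    ring
  simp only [h, map_sum, map_smul, LinearMap.sum_apply, LinearMap.smul_apply, smul_eq_mul,
    Finset.mul_sum]
  conv_lhs => enter [2, c]; rw [Finset.sum_comm]
  rw [Finset.sum_comm]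
  refine Finset.sum_congr rfl fun k _ => ?_
  conv_lhs => enter [2, c]; rw [Finset.sum_comm]
  rw [Finset.sum_comm]
  refine Finset.sum_congr rfl fun i _ => ?_
  conv_lhs => enter [2, c]; rw [Finset.sum_comm]
  rw [Finset.sum_comm]
  refine Finset.sum_congr rfl fun j _ => ?_
  conv_rhs => rw [Finset.sum_comm]
  refine Finset.sum_congr rfl fun c _ => Finset.sum_congr rfl fun c' _ => ?_
  ring

theorem areaRatio_mul_pos (hm : 2 ≤ m) (k : ℕ) :
    0 < areaRatio (m + 1) k * (zonalLead m k * k.factorial)⁻¹ := by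
  have h1 := areaRatio_pos (n := m + 1) (by omega) k
  have h2 := zonalLead_pos hm k
  positivity

theorem rawExpansion_kernel_nonneg (hm : 2 ≤ m) {X : Type*} (u : X → ℝ) (x : X → Fin m → ℝ)
    (hux : ∀ c, u c ^ 2 + ∑ i, x c i ^ 2 = 1) {d : ℕ} {A : Coeffs d} (hA : ∀ k, (A k).PosSemidef)
    (S : Finset X) (α : X → ℝ) :
    0 ≤ ∑ c ∈ S, ∑ c' ∈ S, α c * α c' *
        eval ![u c, u c', u c * u c' + ∑ i, x c i * x c' i] (rawExpansion (m + 1) d A) := by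
  rw [sum_eval_rawExpansion hm u x hux]
  exact Finset.sum_nonneg fun k _ =>
    mul_nonneg (areaRatio_mul_pos hm k).le (sum_mul_fischer_nonneg (hA k) _)

theorem posSemidef_of_kernel_nonneg (hm : 2 ≤ m) {X : Type*} (u : X → ℝ) (x : X → Fin m → ℝ)
    (hux : ∀ c, u c ^ 2 + ∑ i, x c i ^ 2 = 1)
    (hX : ∀ a ∈ Set.Ioo (-1 : ℝ) 1, ∀ y : Fin m → ℝ, ∑ i, y i ^ 2 = 1 →
      ∃ c, u c = a ∧ x c = √(1 - a ^ 2) • y) {d : ℕ} {A : Coeffs d} (hA : ∀ k, (A k).IsSymm)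
    (h : ∀ (S : Finset X) (α : X → ℝ), 0 ≤ ∑ c ∈ S, ∑ c' ∈ S, α c * α c' *
        eval ![u c, u c', u c * u c' + ∑ i, x c i * x c' i] (rawExpansion (m + 1) d A))
    (k : Fin (d + 1)) : (A k).PosSemidef := by
  classical
  refine Matrix.PosSemidef.of_dotProduct_mulVec_nonneg
    ((Matrix.conjTranspose_eq_transpose_of_trivial _).trans (hA k)) fun w => ?_
  obtain ⟨p, hp, hp0⟩ := exists_harm_ne_zero hm k
  let N : Fin (d + 1) → ℕ := fun k => d - k + 1
  -- The target is supported in block `k`; the inverse square root cancels the factor `√h_i` of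
  -- `sum_eval_rawExpansion`, leaving `w i • p`.
  let W : (k : Fin (d + 1)) → Fin (N k) → harm m k :=
    Pi.single k fun i => ((√(harmDim (m + 1 + 2 * k) i))⁻¹ * w i) • ⟨p, hp⟩
  have hW : W ∈ Submodule.span ℝ
      (Set.range fun c => zonalVector hm (m + 1) N (u c) (x c)) := by
    rw [span_zonalVector hm (by omega) N u x hX]; trivial
  obtain ⟨α, hα⟩ := Finsupp.mem_span_range_iff_exists_finsupp.1 hW
  have hval : ∀ k' i, ∑ c ∈ α.support, α c •
      (zonalVector hm (m + 1) N (u c) (x c) k' i : MvPolynomial (Fin m) ℝ) = W k' i := by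
    intro k' i
    rw [← hα, Finsupp.sum]
    simp only [Finset.sum_apply, Pi.smul_apply, Submodule.coe_sum, Submodule.coe_smul]
  have hpos := h α.support α
  rw [sum_eval_rawExpansion hm u x hux, Finset.sum_eq_single k] at hpos
  · have hk : ∀ i : Fin (d - k + 1), √(harmDim (m + 1 + 2 * k) i : ℝ) • ∑ c ∈ α.support, α c •
        (zonalVector hm (m + 1) N (u c) (x c) k i : MvPolynomial (Fin m) ℝ) = w i • p := by
      intro i
      rw [hval]
      simp only [W, Pi.single_eq_same, Submodule.coe_smul, smul_smul]
      rw [mul_inv_cancel_left₀ (sqrt_harmDim_pos (by omega) i).ne']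
    have h1 : 0 ≤ ∑ i, ∑ j, A k i j * fischer (w i • p) (w j • p) := by
      simpa only [← hk] using nonneg_of_mul_nonneg_right hpos (areaRatio_mul_pos hm k)
    have h2 : ∑ i, ∑ j, A k i j * fischer (w i • p) (w j • p) =
        fischer p p * (star w ⬝ᵥ (A k).mulVec w) := by
      simp only [dotProduct, Matrix.mulVec, star_trivial, Finset.mul_sum, map_smul,
        LinearMap.smul_apply, smul_eq_mul]
      refine Finset.sum_congr rfl fun i _ => Finset.sum_congr rfl fun j _ => ?_
      ring
    rw [h2] at h1
    exact nonneg_of_mul_nonneg_right h1 (fischer_self_pos hp0)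
  · intro k' _ hk'
    simp only [N] at hval
    simp only [hval]
    simp [W, Pi.single_eq_of_ne hk']
  · simp

end Kernel

end

end ZonalMatrix

/-! ### Transfer to the sphere and conclusion -/

theorem proposition4p8 (n : ℕ) (hn : 3 ≤ n)
    (e : Metric.sphere (0 : EuclideanSpace ℝ (Fin n)) 1)
    (d : ℕ) (F : ZonalMatrix.Poly3) (hF : F ∈ ZonalMatrix.R d) :
    (∀ A : (k : Fin (d + 1)) → Matrix (Fin (d - k + 1)) (Fin (d - k + 1)) ℝ,
      (∀ k, (A k).IsSymm) → F = ZonalMatrix.expansion n d A →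
        ZonalMatrix.IsPosDef e F → ∀ k, (A k).PosSemidef) ∧
    (ZonalMatrix.IsPosDef e F ↔
      ∃ A : (k : Fin (d + 1)) → Matrix (Fin (d - k + 1)) (Fin (d - k + 1)) ℝ,
        (∀ k, (A k).PosSemidef) ∧ F = ZonalMatrix.expansion n d A) := by
  obtain ⟨m, rfl⟩ : ∃ m, n = m + 1 := ⟨n - 1, by omega⟩
  have hm : 2 ≤ m := by omega
  obtain ⟨x, hx, hX⟩ := ZonalMatrix.exists_sphere_coordinates e
  have hux : ∀ c : Metric.sphere (0 : EuclideanSpace ℝ (Fin (m + 1))) 1,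
      inner ℝ e.1 c.1 ^ 2 + ∑ i, x c i ^ 2 = 1 := fun c => by
    have h := hx c c
    rw [real_inner_self_eq_norm_sq, show ‖c.1‖ = 1 by simp] at h
    simp only [sq]
    linarith
  -- The inner product is put in the form `uv + x·y` used by the kernel lemmas.
  have hpt : ∀ c c' : Metric.sphere (0 : EuclideanSpace ℝ (Fin (m + 1))) 1,
      (![inner ℝ e.1 c.1, inner ℝ e.1 c'.1, inner ℝ c.1 c'.1] : Fin 3 → ℝ) =
        ![inner ℝ e.1 c.1, inner ℝ e.1 c'.1,
          inner ℝ e.1 c.1 * inner ℝ e.1 c'.1 + ∑ i, x c i * x c' i] := fun c c' => by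
    rw [← hx]
  have necessity : ∀ A : ZonalMatrix.Coeffs d, (∀ k, (A k).IsSymm) →
      F = ZonalMatrix.expansion (m + 1) d A → ZonalMatrix.IsPosDef e F →
        ∀ k, (A k).PosSemidef := by
    intro A hA hFA hpos
    refine ZonalMatrix.posSemidef_of_kernel_nonneg hm (fun c => inner ℝ e.1 c.1) x hux hX hA
      fun S α => ?_
    have := hpos S α
    simp only [hpt, hFA, ZonalMatrix.expansion_eq_rawExpansion hn d A hA] at this
    exact this
  refine ⟨necessity, fun hpos => ?_, ?_⟩
  · obtain ⟨A, hA, hFA⟩ := ZonalMatrix.exists_expansion hn hF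
    exact ⟨A, necessity A hA hFA hpos, hFA⟩
  · rintro ⟨A, hA, hFA⟩ S α
    have hsymm : ∀ k, (A k).IsSymm := fun k =>
      (Matrix.conjTranspose_eq_transpose_of_trivial _).symm.trans (hA k).1
    simp only [hpt, hFA, ZonalMatrix.expansion_eq_rawExpansion hn d A hsymm]
    exact ZonalMatrix.rawExpansion_kernel_nonneg hm
      (fun c : Metric.sphere (0 : EuclideanSpace ℝ (Fin (m + 1))) 1 => inner ℝ e.1 c.1)
      x hux hA S α
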